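/- **Theorem (oracle inequalities for the Elastic-net in negative binomial regression under the Stabil condition).** Let $\theta>0$, $L>0$, $B>0$, $\varepsilon_n\ge 0$, $A>1$ be real numbers and $n,p\ge1$ integers, and let $\beta^*\in\mathbb R^p$ have $\|\beta^*\|_1\le B$. Write $H=\{j:\beta^*_j\ne0\}$ and $d^*=|H|$. Let $(X_i,Y_i)$, $1\le i\le n$, be i.i.d. copies of a pair $(X,Y)\in\mathbb R^p\times\mathbb N$ such that $\|X\|_\infty\le L$ almost surely and, given $X=x$, $Y$ is negative binomial with dispersion $\theta$ and mean $\mu=\exp(x^T\beta^*)$, that is $$P(Y=y\mid X=x)=\frac{\Gamma(\theta+y)}{\Gamma(\theta)\,y!}\Big(\frac{\mu}{\theta+\mu}\Big)^{y}\Big(\frac{\theta}{\theta+\mu}\Big)^{\theta},\qquad y=0,1,2,\dots$$ For $c,\varepsilon\ge 0$ put $V(c,\varepsilon)=\{b\in\mathbb R^p:\|b_{H^c}\|_1\le c\|b_H\|_1+\varepsilon\}$. Let $\Sigma=\mathrm E(XX^T)$ and assume the Stabil condition $S(3.5,\varepsilon_n,k)$: $0<k<1$ and $b^T\Sigma b\ge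 k\|b_H\|_2^2-\varepsilon_n$ for all $b\in V(3.5,\varepsilon_n)$. Put $M=16B+2\varepsilon_n$, $$a=\min_{|x|\le L(M+B),\ |y|\le LB}\ \frac12\,\frac{\theta e^x(e^y+\theta)}{(\theta+e^x)^2},$$ and let $C$ be the smallest constant $C\ge0$ such that $\mathrm E\,Z^m\le m!\,C^m$ for all integers $m\ge1$ and every negative binomial variable $Z$ with dispersion $\theta$ and mean in $[e^{-LB},e^{LB}]$. Let $$G_1=32A^2LC\,\frac{\log 2p}{n},\qquad G_2=16\sqrt2\,ALC\sqrt{\frac{\log 2p}{n}},\qquad G_3=\frac{20\,\theta AML}{M+\varepsilon_n}\sqrt{\frac{2\log 2p}{n}},$$ let $\lambda_1\ge\max(G_1,G_2,G_3)$ and $\lambda_2=\lambda_1/(8B)$. Let $\hat\beta$ be the Elastic-net estimator, i.e. a minimiser over the parameter domain $D\subseteq\mathbb R^p$ (any set containing $\beta^*$, for instance $D=\mathbb R^p$) of $$-\frac1n\sum_{i=1}^n\big[Y_iX_i^T\beta-(\theta+Y_i)\log(\theta+e^{X_i^T\beta})\big]+\lambda_1\|\beta\|_1+\lambda_2\|\beta\|_2^2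 .$$ Then $a>0$, and there is an event of probability at least $1-2(2p)^{1-A^2}-(2p)^{-A^2}$ on which all of the following hold: $$\hat\beta-\beta^*\in V\big(3.5,\tfrac{\varepsilon_n}{2}\big),$$ $$\|\hat\beta-\beta^*\|_1\le\frac{2.25^2\,\lambda_1d^*}{ak+2\lambda_2}+\Big(1+\frac a{\lambda_1}\Big)\varepsilon_n,$$ $$\mathrm E_X\big[X^T(\beta^*-\hat\beta)\big]^2\le\frac{17.71875\,d^*\lambda_1^2}{a(ak+2\lambda_2)}+\Big(\frac{4.5\lambda_1}{a}+3.5\Big)\varepsilon_n,$$ where $\mathrm E_X$ is the expectation over a copy of $X$ independent of the sample, so that the left side equals $(\hat\beta-\beta^*)^T\Sigma(\hat\beta-\beta^*)$. -/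

import Mathlib

open MeasureTheory ProbabilityTheory
open scoped ENNReal Matrix

noncomputable section

namespace NBReg

/-- Probability mass function of the negative binomial law with dispersion `θ` and mean `μ`:
`Γ(θ + y) / (Γ(θ) y!) * (μ / (θ + μ)) ^ y * (θ / (θ + μ)) ^ θ`. -/
def nbPMF (θ μ : ℝ) (y : ℕ) : ℝ :=
  Real.Gamma (θ + y) / (Real.Gamma θ * (y.factorial : ℝ)) * (μ / (θ + μ)) ^ y *
    (θ / (θ + μ)) ^ θ

/-- The negative binomial law on `ℕ` with dispersion `θ` and mean `μ`. -/
def nbMeasure (θ μ : ℝ) : Measure ℕ :=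
  Measure.sum fun y : ℕ => ENNReal.ofReal (nbPMF θ μ y) • Measure.dirac y

/-- The smallest constant `C ≥ 0` such that `E Y ^ k ≤ k! * C ^ k` for all `k ≥ 1` and all negative
binomial variables `Y` with dispersion `θ` and mean `exp t`, `|t| ≤ R`. The natural parameter
`η = t - log (θ + exp t)` of such a variable satisfies `|η| ≤ R + log (θ + exp R)`. -/
def momentConst (θ R : ℝ) : ℝ :=
  sInf {C : ℝ | 0 ≤ C ∧ ∀ t : ℝ, |t| ≤ R → ∀ k : ℕ, 1 ≤ k →
    ∫⁻ y, ENNReal.ofReal ((y : ℝ) ^ k) ∂(nbMeasure θ (Real.exp t)) ≤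
      ENNReal.ofReal ((k.factorial : ℝ) * C ^ k)}

/-- The `ℓ₁` norm on `ℝ^p`. -/
def l1Norm {p : ℕ} (b : Fin p → ℝ) : ℝ := ∑ j, |b j|

/-- The average negative log-likelihood (up to an additive constant) of negative binomial regression
with log link, for the data `(x i, y i)`. -/
def nbLoss {n p : ℕ} (θ : ℝ) (x : Fin n → Fin p → ℝ) (y : Fin n → ℕ) (β : Fin p → ℝ) : ℝ :=
  -(1 / (n : ℝ)) * ∑ i, ((y i : ℝ) * (x i ⬝ᵥ β) -
    (θ + (y i : ℝ)) * Real.log (θ + Real.exp (x i ⬝ᵥ β)))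

/-- The Elastic-net criterion. -/
def enObjective {n p : ℕ} (θ lam₁ lam₂ : ℝ) (x : Fin n → Fin p → ℝ) (y : Fin n → ℕ)
    (β : Fin p → ℝ) : ℝ :=
  nbLoss θ x y β + lam₁ * l1Norm β + lam₂ * ∑ j, β j ^ 2

/-- `b` minimises the Elastic-net criterion over the parameter domain `D`. -/
def IsElasticNet {n p : ℕ} (D : Set (Fin p → ℝ)) (θ lam₁ lam₂ : ℝ) (x : Fin n → Fin p → ℝ)
    (y : Fin n → ℕ) (b : Fin p → ℝ) : Prop :=
  b ∈ D ∧ ∀ β ∈ D, enObjective θ lam₁ lam₂ x y b ≤ enObjective θ lam₁ lam₂ x y β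

/-- The support `H = {j : β j ≠ 0}`. -/
def supp {p : ℕ} (β : Fin p → ℝ) : Finset (Fin p) := Finset.univ.filter fun j => β j ≠ 0

/-- The restricted set `V(c, ε) = {b : ‖b_{Hᶜ}‖₁ ≤ c ‖b_H‖₁ + ε}`. -/
def coneV {p : ℕ} (H : Finset (Fin p)) (c ε : ℝ) : Set (Fin p → ℝ) :=
  {b | ∑ j ∈ Hᶜ, |b j| ≤ c * ∑ j ∈ H, |b j| + ε}

/-- The second moment matrix `Σ = E (X Xᵀ)` of the law `ν` of `X`. -/
def secondMoment {p : ℕ} (ν : Measure (Fin p → ℝ)) : Matrix (Fin p) (Fin p) ℝ :=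
  Matrix.of fun j l => ∫ x, x j * x l ∂ν

/-- The Stabil condition `S(c, ε, k)` for the matrix `S` and the index set `H`. -/
def Stabil {p : ℕ} (S : Matrix (Fin p) (Fin p) ℝ) (H : Finset (Fin p)) (c ε k : ℝ) : Prop :=
  0 < k ∧ k < 1 ∧ ∀ b ∈ coneV H c ε, k * ∑ j ∈ H, b j ^ 2 - ε ≤ b ⬝ᵥ (S *ᵥ b)

/-- The constant `a`, the minimum of `(1/2) * θ eˣ (eʸ + θ) / (θ + eˣ)²` over
`|x| ≤ L (M + B)`, `|y| ≤ L B`. -/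
def curvConst (θ L B M : ℝ) : ℝ :=
  sInf ((fun q : ℝ × ℝ => 1 / 2 * (θ * Real.exp q.1 * (Real.exp q.2 + θ) /
    (θ + Real.exp q.1) ^ 2)) '' {q : ℝ × ℝ | |q.1| ≤ L * (M + B) ∧ |q.2| ≤ L * B})

/-- `(X i, Y i)`, `i < n`, is an i.i.d. sample of negative binomial regression with random design:
the covariates have law `ν`, and given `X i = x` the response is negative binomial with
dispersion `θ` and mean `exp (xᵀ β)`. -/
structure IsNBSample {n p : ℕ} {Ω : Type*} [MeasurableSpace Ω] (P : Measure Ω)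
    [IsProbabilityMeasure P] (ν : Measure (Fin p → ℝ)) (θ : ℝ) (β : Fin p → ℝ)
    (X : Fin n → Ω → Fin p → ℝ) (Y : Fin n → Ω → ℕ) : Prop where
  measurable_X : ∀ i, Measurable (X i)
  measurable_Y : ∀ i, Measurable (Y i)
  indep : iIndepFun (fun i ω => (X i ω, Y i ω)) P
  law_X : ∀ i, P.map (X i) = ν
  cond_law : ∀ i, ∀ᵐ x ∂ν, condDistrib (Y i) (X i) P x = nbMeasure θ (Real.exp (x ⬝ᵥ β))

end NBReg

end

noncomputable section

namespace NBReg

/-! Two random quantities have to be controlled: the score at `βstar`, coordinate by coordinate, and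
the centred empirical risk increment, uniformly over an ℓ₁ ball of one fixed radius `R`. On the
event where both are small, everything else is convexity.

Probability. Factorial moment bounds give finite exponential moments, with exponent `(qC)² / (1 -
qC)`. For the score, Chernoff and a union bound over `2p` signed coordinates suffice
(`IsCountModel.measure_score_le`). For the increments, the loss is `max y θ`-Lipschitz in the linear
predictor. Symmetrization and a contraction principle for the exponential of a supremum replace it
by a linear form. Over an ℓ₁ ball this is dominated by the `2p` signed coordinates
(`lintegral_expSup_empirical_le`, `IsCountModel.measure_uniform_le`). Suprema of exponentials live
in `ℝ≥0∞`, so no boundedness is needed.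

Determinism (`oracle_of_deviation`). The score bound and convexity of the loss put the error `δ` in
a cone. Let `T` be the claimed ℓ₁ bound and `R = min T M`. If `‖δ‖₁ > R`, shrink `δ` to norm `R`; by
convexity the criterion still does not exceed its value at `βstar`. Inside radius `M` the population
risk has curvature `a`, so the quadratic form is at most deviation plus penalty difference. If `R =
M` the penalty alone gives a contradiction. If `R = T`, the Stabil condition and Cauchy–Schwarz do
(`no_crossing`). Hence `‖δ‖₁ ≤ R`, and the same inequality, unshrunk, gives the prediction bound. -/

/-! ### The negative binomial series, exponential moments and mean -/

lemma ring_choose_eq_Gamma {θ : ℝ} (hθ : 0 < θ) (n : ℕ) :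
    Ring.choose (θ + n - 1) n = Real.Gamma (θ + n) / (Real.Gamma θ * (n.factorial : ℝ)) := by
  have hG := Real.Gamma_pos_of_pos hθ
  have key : ∀ n : ℕ, (ascPochhammer ℕ n).smeval θ * Real.Gamma θ = Real.Gamma (θ + n) := by
    intro n
    rw [Polynomial.ascPochhammer_smeval_eq_eval]
    induction n with
    | zero => simp
    | succ n ih =>
      rw [ascPochhammer_succ_right, Polynomial.eval_mul]
      simp only [Polynomial.eval_add, Polynomial.eval_X, Polynomial.eval_natCast]
      rw [mul_right_comm, ih, Nat.cast_add, Nat.cast_one, ← add_assoc,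
        Real.Gamma_add_one (by positivity)]
      ring
  rw [← Ring.multichoose_eq]
  have h := Ring.factorial_nsmul_multichoose_eq_ascPochhammer θ n
  rw [nsmul_eq_mul] at h
  have hf : (n.factorial : ℝ) ≠ 0 := by positivity
  rw [← key n, ← h]
  field_simp

lemma hasSum_negBinomial {θ q : ℝ} (hθ : 0 < θ) (hq0 : 0 ≤ q) (hq1 : q < 1) :
    HasSum (fun y : ℕ => Real.Gamma (θ + y) / (Real.Gamma θ * (y.factorial : ℝ)) * q ^ y)
      ((1 - q) ^ (-θ)) := by
  have h := (Real.one_div_one_sub_rpow_hasFPowerSeriesOnBall_zero θ).hasSum (y := q)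
    (by simpa [enorm_eq_nnnorm, ← NNReal.coe_lt_one, abs_of_nonneg hq0] using hq1)
  simp only [FormalMultilinearSeries.ofScalars_apply_eq, zero_add, smul_eq_mul] at h
  rw [Real.rpow_neg (by linarith), ← one_div]
  refine h.congr_fun ?_
  intro y
  rw [ring_choose_eq_Gamma hθ]

lemma nbPMF_nonneg {θ μ : ℝ} (hθ : 0 < θ) (hμ : 0 < μ) (y : ℕ) : 0 ≤ nbPMF θ μ y := by
  have := Real.Gamma_pos_of_pos hθ
  have := Real.Gamma_pos_of_pos (show 0 < θ + y by positivity)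
  unfold nbPMF
  positivity

lemma lintegral_nbMeasure (θ μ : ℝ) (f : ℕ → ℝ≥0∞) :
    ∫⁻ y, f y ∂(nbMeasure θ μ) = ∑' y, ENNReal.ofReal (nbPMF θ μ y) * f y := by
  simp [nbMeasure, lintegral_sum_measure, lintegral_smul_measure, lintegral_dirac]

lemma lintegral_exp_nbMeasure {θ μ s : ℝ} (hθ : 0 < θ) (hμ : 0 < μ)
    (hs : μ / (θ + μ) * Real.exp s < 1) :
    ∫⁻ y, ENNReal.ofReal (Real.exp (s * y)) ∂(nbMeasure θ μ) =
      ENNReal.ofReal ((1 - μ / (θ + μ) * Real.exp s) ^ (-θ) * (θ / (θ + μ)) ^ θ) := by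
  have h := (hasSum_negBinomial hθ (by positivity) hs).mul_right ((θ / (θ + μ)) ^ θ)
  have e : ∀ y : ℕ, Real.Gamma (θ + y) / (Real.Gamma θ * (y.factorial : ℝ)) *
      (μ / (θ + μ) * Real.exp s) ^ y * (θ / (θ + μ)) ^ θ = nbPMF θ μ y * Real.exp (s * y) := by
    intro y
    rw [nbPMF, mul_pow, mul_comm s, Real.exp_nat_mul]
    ring
  simp only [e] at h
  rw [lintegral_nbMeasure, ← h.tsum_eq, ENNReal.ofReal_tsum_of_nonneg _ h.summable]
  · exact tsum_congr fun y => (ENNReal.ofReal_mul (nbPMF_nonneg hθ hμ y)).symm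
  · exact fun y => mul_nonneg (nbPMF_nonneg hθ hμ y) (Real.exp_nonneg _)

/-- The factor `y` cancels one step of the factorial; shifting the index by one leaves the negative
binomial series with dispersion `θ + 1`. -/
lemma lintegral_id_nbMeasure {θ μ : ℝ} (hθ : 0 < θ) (hμ : 0 < μ) :
    ∫⁻ y, ENNReal.ofReal (y : ℝ) ∂(nbMeasure θ μ) = ENNReal.ofReal μ := by
  have hq : μ / (θ + μ) < 1 := by rw [div_lt_one (by positivity)]; linarith
  have h := ((hasSum_negBinomial (θ := θ + 1) (by linarith) (by positivity) hq).mul_left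
    (θ * (μ / (θ + μ)))).mul_right ((θ / (θ + μ)) ^ θ)
  have h1 : 1 - μ / (θ + μ) = θ / (θ + μ) := by field_simp; ring
  have hval : θ * (μ / (θ + μ)) * (1 - μ / (θ + μ)) ^ (-(θ + 1)) * (θ / (θ + μ)) ^ θ = μ := by
    rw [h1, mul_assoc, ← Real.rpow_add (by positivity)]
    have : -(θ + 1) + θ = -1 := by ring
    rw [this, Real.rpow_neg_one]
    field_simp
  rw [hval] at h
  have hG := (Real.Gamma_pos_of_pos hθ).ne'
  have e : ∀ y : ℕ, θ * (μ / (θ + μ)) * (Real.Gamma (θ + 1 + y) /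
      (Real.Gamma (θ + 1) * (y.factorial : ℝ)) * (μ / (θ + μ)) ^ y) * (θ / (θ + μ)) ^ θ =
      nbPMF θ μ (y + 1) * ((y + 1 : ℕ) : ℝ) := by
    intro y
    rw [nbPMF, Real.Gamma_add_one hθ.ne', Nat.factorial_succ, pow_succ]
    have : θ + ((y + 1 : ℕ) : ℝ) = θ + 1 + y := by push_cast; ring
    rw [this]
    push_cast
    field_simp
  simp only [e] at h
  have h' := (hasSum_nat_add_iff (f := fun y : ℕ => nbPMF θ μ y * (y : ℝ)) 1).1 h
  simp only [Finset.range_one, Finset.sum_singleton, Nat.cast_zero, mul_zero, add_zero] at h'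
  conv_rhs => rw [← h'.tsum_eq]
  rw [lintegral_nbMeasure, ENNReal.ofReal_tsum_of_nonneg _ h'.summable]
  · exact tsum_congr fun y => (ENNReal.ofReal_mul (nbPMF_nonneg hθ hμ y)).symm
  · exact fun y => mul_nonneg (nbPMF_nonneg hθ hμ y) (Nat.cast_nonneg _)

/-! ### The moment constant -/

/-- The constants admissible in the definition of `momentConst`. -/
def momentBounds (θ R : ℝ) : Set ℝ :=
  {C : ℝ | 0 ≤ C ∧ ∀ t : ℝ, |t| ≤ R → ∀ k : ℕ, 1 ≤ k →
    ∫⁻ y, ENNReal.ofReal ((y : ℝ) ^ k) ∂(nbMeasure θ (Real.exp t)) ≤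
      ENNReal.ofReal ((k.factorial : ℝ) * C ^ k)}

/-- Needed because the infimum of an empty set of reals is the default value 0. An exponential
moment bounded uniformly over the means controls all moments at once. -/
lemma momentBounds_nonempty {θ R : ℝ} (hθ : 0 < θ) : (momentBounds θ R).Nonempty := by
  set q₀ := Real.exp R / (θ + Real.exp R) with hq₀
  have hq0 : 0 < q₀ := by positivity
  have hq1 : q₀ < 1 := by
    rw [hq₀, div_lt_one (by positivity)]; linarith
  -- Chosen so that `q₀ * exp s` is the midpoint of `q₀` and 1: the series still converges for the
  -- largest admissible mean.
  set s := Real.log ((1 + q₀) / (2 * q₀)) with hs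
  have hs0 : 0 < s := Real.log_pos (by rw [lt_div_iff₀ (by positivity)]; linarith)
  have hes : Real.exp s = (1 + q₀) / (2 * q₀) := Real.exp_log (by positivity)
  set K := max 1 (((1 - q₀) / 2) ^ (-θ)) with hK
  have hK1 : 1 ≤ K := le_max_left _ _
  have hexp : ∀ t : ℝ, |t| ≤ R →
      ∫⁻ y, ENNReal.ofReal (Real.exp (s * y)) ∂(nbMeasure θ (Real.exp t)) ≤ ENNReal.ofReal K := by
    intro t ht
    have hle : Real.exp t / (θ + Real.exp t) ≤ q₀ := by
      rw [hq₀, div_le_div_iff₀ (by positivity) (by positivity)]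
      have : Real.exp t ≤ Real.exp R := Real.exp_le_exp.2 (le_of_abs_le ht)
      nlinarith
    have hle2 : Real.exp t / (θ + Real.exp t) * Real.exp s ≤ (1 + q₀) / 2 := by
      calc _ ≤ q₀ * Real.exp s := by gcongr
        _ = _ := by rw [hes]; field_simp
    rw [lintegral_exp_nbMeasure hθ (Real.exp_pos t) (by linarith)]
    apply ENNReal.ofReal_le_ofReal
    have h1 : (1 - Real.exp t / (θ + Real.exp t) * Real.exp s) ^ (-θ) ≤ ((1 - q₀) / 2) ^ (-θ) :=
      Real.rpow_le_rpow_of_nonpos (by linarith) (by linarith) (by linarith)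
    have h2 : (θ / (θ + Real.exp t)) ^ θ ≤ 1 :=
      Real.rpow_le_one (by positivity)
        (by rw [div_le_one (by positivity)]; linarith [Real.exp_pos t]) hθ.le
    calc _ ≤ ((1 - q₀) / 2) ^ (-θ) * 1 := by
          gcongr
      _ ≤ K := by rw [mul_one]; exact le_max_right _ _
  -- From `y ^ k ≤ k! / s ^ k * exp (s y)`; the single factor `K` is absorbed since `K ≤ K ^ k` for
  -- `K, k ≥ 1`.
  refine ⟨K / s, by positivity, fun t ht k hk => ?_⟩
  calc ∫⁻ y, ENNReal.ofReal ((y : ℝ) ^ k) ∂(nbMeasure θ (Real.exp t))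
      ≤ ∫⁻ y, ENNReal.ofReal (k.factorial / s ^ k) * ENNReal.ofReal (Real.exp (s * y))
          ∂(nbMeasure θ (Real.exp t)) := by
        refine lintegral_mono fun y => ?_
        rw [← ENNReal.ofReal_mul (by positivity)]
        apply ENNReal.ofReal_le_ofReal
        have := Real.pow_div_factorial_le_exp (s * y) (by positivity) k
        rw [div_le_iff₀ (by positivity), mul_pow] at this
        rw [div_mul_eq_mul_div, le_div_iff₀ (by positivity)]
        linarith
    _ = ENNReal.ofReal (k.factorial / s ^ k) *
          ∫⁻ y, ENNReal.ofReal (Real.exp (s * y)) ∂(nbMeasure θ (Real.exp t)) :=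
        lintegral_const_mul _ (measurable_of_countable _)
    _ ≤ ENNReal.ofReal (k.factorial / s ^ k) * ENNReal.ofReal K := by gcongr; exact hexp t ht
    _ ≤ _ := by
        rw [← ENNReal.ofReal_mul (by positivity)]
        apply ENNReal.ofReal_le_ofReal
        rw [div_pow, div_mul_eq_mul_div, mul_div_assoc]
        gcongr
        exact le_self_pow₀ hK1 (by omega)

lemma momentConst_eq (θ R : ℝ) : momentConst θ R = sInf (momentBounds θ R) := rfl

lemma momentConst_nonneg (θ R : ℝ) : 0 ≤ momentConst θ R :=
  Real.sInf_nonneg fun _ h => h.1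

/-- The admissible set is closed, so the infimum is itself admissible: pass to the limit along a
minimising sequence. -/
lemma lintegral_pow_nbMeasure_le {θ R t : ℝ} (hθ : 0 < θ) (ht : |t| ≤ R) {k : ℕ} (hk : 1 ≤ k) :
    ∫⁻ y, ENNReal.ofReal ((y : ℝ) ^ k) ∂(nbMeasure θ (Real.exp t)) ≤
      ENNReal.ofReal ((k.factorial : ℝ) * momentConst θ R ^ k) := by
  obtain ⟨u, -, hu, hmem⟩ := exists_seq_tendsto_sInf (momentBounds_nonempty (R := R) hθ)
    ⟨0, fun _ h => h.1⟩
  rw [momentConst_eq]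
  refine ge_of_tendsto' (ENNReal.tendsto_ofReal ((hu.pow k).const_mul _)) fun m => ?_
  exact (hmem m).2 t ht k hk

/-- The variable of mean 1 already forces this. It is what later makes `lam₁` positive. -/
lemma one_le_momentConst {θ R : ℝ} (hθ : 0 < θ) (hR : 0 ≤ R) : 1 ≤ momentConst θ R := by
  have h := lintegral_pow_nbMeasure_le (t := 0) (R := R) hθ (by simpa using hR) le_rfl
  simp only [pow_one, Real.exp_zero, lintegral_id_nbMeasure hθ one_pos] at h
  have := (ENNReal.ofReal_le_ofReal_iff (mul_nonneg (by positivity) (momentConst_nonneg θ R))).1 h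
  simpa using this

/-! ### Exponential moments from factorial moment bounds -/

/-- The exponential remainder `exp u - 1 - u`. -/
def expRem (u : ℝ) : ℝ := Real.exp u - 1 - u

lemma expRem_nonneg (u : ℝ) : 0 ≤ expRem u := by
  unfold expRem; linarith [Real.add_one_le_exp u]

/-- Since `cosh u = exp u - sinh u` and `sinh u ≥ u`, no linear term survives; this keeps later
bounds quadratic in the tilt. -/
lemma cosh_le_one_add_expRem {u : ℝ} (hu : 0 ≤ u) : Real.cosh u ≤ 1 + expRem u := by
  have := Real.self_le_sinh_iff.2 hu
  have h2 := Real.cosh_add_sinh u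
  unfold expRem
  linarith

lemma expRem_le_expRem_abs (u : ℝ) : expRem u ≤ expRem |u| := by
  rcases le_total 0 u with h | h
  · rw [abs_of_nonneg h]
  · rw [abs_of_nonpos h]
    have := Real.self_le_sinh_iff.2 (neg_nonneg.2 h)
    rw [Real.sinh_eq] at this
    simp only [neg_neg] at this
    unfold expRem
    linarith

lemma hasSum_expRem (u : ℝ) :
    HasSum (fun m : ℕ => u ^ (m + 2) / ((m + 2).factorial : ℝ)) (expRem u) := by
  have h : HasSum (fun m : ℕ => u ^ m / (m.factorial : ℝ)) (Real.exp u) := by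
    rw [Real.exp_eq_exp_ℝ]
    exact NormedSpace.expSeries_div_hasSum_exp u
  have := (hasSum_nat_add_iff' 2).2 h
  have e : expRem u = Real.exp u - ∑ i ∈ Finset.range 2, u ^ i / (i.factorial : ℝ) := by
    norm_num [Finset.sum_range_succ, expRem]
    ring
  rwa [e]

/-- The law `κ` on `ℕ` has `m`-th moment at most `m! * C ^ m` for all `m ≥ 1`. -/
def HasMomentBound (κ : Measure ℕ) (C : ℝ) : Prop :=
  ∀ k : ℕ, 1 ≤ k → ∫⁻ y, ENNReal.ofReal ((y : ℝ) ^ k) ∂κ ≤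
    ENNReal.ofReal ((k.factorial : ℝ) * C ^ k)

/-- Integrating the Taylor series termwise, the factorials cancel and a geometric series in `q * C`
starting at exponent 2 remains. -/
lemma lintegral_expRem_le {κ : Measure ℕ} {C q : ℝ} (hC : 0 ≤ C) (hκ : HasMomentBound κ C)
    (hq : 0 ≤ q) (hqC : q * C < 1) :
    ∫⁻ y, ENNReal.ofReal (expRem (q * y)) ∂κ ≤
      ENNReal.ofReal ((q * C) ^ 2 / (1 - q * C)) := by
  have e : ∀ y : ℕ, ENNReal.ofReal (expRem (q * y)) =
      ∑' m : ℕ, ENNReal.ofReal ((q * y) ^ (m + 2) / ((m + 2).factorial : ℝ)) := fun y => by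
    rw [← (hasSum_expRem _).tsum_eq, ENNReal.ofReal_tsum_of_nonneg (fun m => by positivity)
      (hasSum_expRem _).summable]
  have hg : HasSum (fun m : ℕ => (q * C) ^ (m + 2)) ((q * C) ^ 2 / (1 - q * C)) := by
    have := (hasSum_geometric_of_lt_one (mul_nonneg hq hC) hqC).mul_left ((q * C) ^ 2)
    simpa [pow_add, mul_comm, div_eq_mul_inv] using this
  simp only [e]
  rw [lintegral_tsum fun m => (measurable_of_countable _).aemeasurable, ← hg.tsum_eq,
    ENNReal.ofReal_tsum_of_nonneg (fun m => by positivity) hg.summable]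
  refine ENNReal.tsum_le_tsum fun m => ?_
  calc ∫⁻ y, ENNReal.ofReal ((q * y) ^ (m + 2) / ((m + 2).factorial : ℝ)) ∂κ
      = ∫⁻ y, ENNReal.ofReal (q ^ (m + 2) / ((m + 2).factorial : ℝ)) *
          ENNReal.ofReal ((y : ℝ) ^ (m + 2)) ∂κ := by
        refine lintegral_congr fun y => ?_
        rw [← ENNReal.ofReal_mul (by positivity), mul_pow]
        congr 1; ring
    _ = ENNReal.ofReal (q ^ (m + 2) / ((m + 2).factorial : ℝ)) *
          ∫⁻ y, ENNReal.ofReal ((y : ℝ) ^ (m + 2)) ∂κ :=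
        lintegral_const_mul _ (measurable_of_countable _)
    _ ≤ ENNReal.ofReal (q ^ (m + 2) / ((m + 2).factorial : ℝ)) *
          ENNReal.ofReal (((m + 2).factorial : ℝ) * C ^ (m + 2)) := by
        gcongr
        exact hκ _ (by omega)
    _ = _ := by
        rw [← ENNReal.ofReal_mul (by positivity), mul_pow]
        congr 1
        field_simp

lemma integrable_natCast_of_lintegral {κ : Measure ℕ} {μ : ℝ}
    (hmean : ∫⁻ y, ENNReal.ofReal (y : ℝ) ∂κ = ENNReal.ofReal μ) :
    Integrable (fun y : ℕ => (y : ℝ)) κ := by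
  refine ⟨(measurable_of_countable _).aestronglyMeasurable, ?_⟩
  rw [hasFiniteIntegral_iff_ofReal (ae_of_all _ fun y => Nat.cast_nonneg y), hmean]
  exact ENNReal.ofReal_lt_top

lemma integral_natCast_of_lintegral {κ : Measure ℕ} {μ : ℝ} (hμ : 0 ≤ μ)
    (hmean : ∫⁻ y, ENNReal.ofReal (y : ℝ) ∂κ = ENNReal.ofReal μ) :
    ∫ y, (y : ℝ) ∂κ = μ := by
  rw [integral_eq_lintegral_of_nonneg_ae (ae_of_all _ fun y => Nat.cast_nonneg y)
    (measurable_of_countable _).aestronglyMeasurable, hmean, ENNReal.toReal_ofReal hμ]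

/-- The linear term of `exp (w y)` is kept exactly, and centring cancels its mean `w μ`; only the
quadratic remainder costs anything. -/
lemma lintegral_exp_centered_le {κ : Measure ℕ} [IsProbabilityMeasure κ] {C μ w : ℝ} (hC : 0 ≤ C)
    (hκ : HasMomentBound κ C) (hμ : 0 ≤ μ)
    (hmean : ∫⁻ y, ENNReal.ofReal (y : ℝ) ∂κ = ENNReal.ofReal μ) (hw : |w| * C < 1) :
    ∫⁻ y, ENNReal.ofReal (Real.exp (w * (y - μ))) ∂κ ≤
      ENNReal.ofReal (Real.exp ((|w| * C) ^ 2 / (1 - |w| * C))) := by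
  have hb := lintegral_expRem_le hC hκ (abs_nonneg w) hw
  set b := (|w| * C) ^ 2 / (1 - |w| * C) with hbdef
  have hb0 : 0 ≤ b := div_nonneg (by positivity) (by linarith)
  have hi1 := integrable_natCast_of_lintegral hmean
  have hi2 : Integrable (fun y : ℕ => expRem (|w| * y)) κ := by
    refine ⟨(measurable_of_countable _).aestronglyMeasurable, ?_⟩
    rw [hasFiniteIntegral_iff_ofReal (ae_of_all _ fun y => expRem_nonneg _)]
    exact hb.trans_lt ENNReal.ofReal_lt_top
  have hi3 : ∫ y : ℕ, expRem (|w| * y) ∂κ ≤ b := by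
    rw [integral_eq_lintegral_of_nonneg_ae (ae_of_all _ fun y => expRem_nonneg _)
      (measurable_of_countable _).aestronglyMeasurable]
    exact ENNReal.toReal_le_of_le_ofReal hb0 hb
  have hpt : ∀ y : ℕ, Real.exp (w * y) ≤ 1 + w * y + expRem (|w| * y) := fun y => by
    have := expRem_le_expRem_abs (w * y)
    rw [abs_mul, Nat.abs_cast] at this
    unfold expRem at this ⊢
    linarith
  have hint : Integrable (fun y : ℕ => 1 + w * (y : ℝ) + expRem (|w| * y)) κ :=
    ((integrable_const 1).add (hi1.const_mul w)).add hi2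
  calc ∫⁻ y, ENNReal.ofReal (Real.exp (w * (y - μ))) ∂κ
      = ∫⁻ y : ℕ, ENNReal.ofReal (Real.exp (-(w * μ))) * ENNReal.ofReal (Real.exp (w * y)) ∂κ := by
        refine lintegral_congr fun y => ?_
        rw [← ENNReal.ofReal_mul (Real.exp_nonneg _), ← Real.exp_add]
        congr 2; ring
    _ = ENNReal.ofReal (Real.exp (-(w * μ))) * ∫⁻ y : ℕ, ENNReal.ofReal (Real.exp (w * y)) ∂κ :=
        lintegral_const_mul _ (measurable_of_countable _)
    _ ≤ ENNReal.ofReal (Real.exp (-(w * μ))) *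
          ∫⁻ y : ℕ, ENNReal.ofReal (1 + w * y + expRem (|w| * y)) ∂κ := by
        gcongr with y
        exact hpt y
    _ = ENNReal.ofReal (Real.exp (-(w * μ))) *
          ENNReal.ofReal (∫ y : ℕ, 1 + w * (y : ℝ) + expRem (|w| * y) ∂κ) := by
        rw [ofReal_integral_eq_lintegral_ofReal hint
          (ae_of_all _ fun y => (Real.exp_nonneg _).trans (hpt y))]
    _ ≤ ENNReal.ofReal (Real.exp (-(w * μ))) * ENNReal.ofReal (Real.exp (w * μ + b)) := by
        gcongr
        have h1 : ∫ y : ℕ, 1 + w * (y : ℝ) + expRem (|w| * y) ∂κ =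
            ∫ y : ℕ, 1 + w * (y : ℝ) ∂κ + ∫ y : ℕ, expRem (|w| * y) ∂κ :=
          integral_add ((integrable_const 1).add (hi1.const_mul w)) hi2
        have h2 : ∫ y : ℕ, 1 + w * (y : ℝ) ∂κ = 1 + w * μ := by
          rw [integral_add (integrable_const 1) (hi1.const_mul w), integral_const_mul,
            integral_natCast_of_lintegral hμ hmean]
          simp
        rw [h1, h2]
        linarith [Real.add_one_le_exp (w * μ + b)]
    _ = _ := by
        rw [← ENNReal.ofReal_mul (Real.exp_nonneg _), ← Real.exp_add]
        congr 2; ring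

/-! ### Contraction for exponentials of suprema -/

/-- The supremum of `exp (A a)` over `a`, as an extended nonnegative real. -/
def expSup {ι : Type*} (A : ι → ℝ) : ℝ≥0∞ := ⨆ a, ENNReal.ofReal (Real.exp (A a))

lemma ofReal_exp_le_expSup {ι : Type*} (A : ι → ℝ) (a : ι) :
    ENNReal.ofReal (Real.exp (A a)) ≤ expSup A :=
  le_iSup (fun a => ENNReal.ofReal (Real.exp (A a))) a

lemma measurable_expSup {ι α : Type*} [Countable ι] [MeasurableSpace α] {f : α → ι → ℝ}
    (hf : ∀ a, Measurable fun z => f z a) : Measurable fun z => expSup (f z) :=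
  Measurable.iSup fun a => (Real.measurable_exp.comp (hf a)).ennreal_ofReal

/-- Convexity of `exp`: a longer increment from a higher point gains at least as much. -/
lemma exp_add_exp_le_of_le {P Q d₁ d₂ : ℝ} (hQP : Q ≤ P) (h0 : 0 ≤ d₁) (hd : d₁ ≤ d₂) :
    Real.exp (Q + d₁) + Real.exp P ≤ Real.exp (P + d₂) + Real.exp Q := by
  have h1 : Real.exp Q ≤ Real.exp P := Real.exp_le_exp.2 hQP
  have h2 : Real.exp d₁ ≤ Real.exp d₂ := Real.exp_le_exp.2 hd
  have h3 : 1 ≤ Real.exp d₁ := Real.one_le_exp h0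
  have h4 := Real.exp_pos Q
  rw [Real.exp_add, Real.exp_add]
  nlinarith [mul_le_mul h1 (sub_le_sub_right h2 1) (by linarith) (Real.exp_pos P).le]

/-- If one index would serve better in both slots, use it twice and compare hyperbolic cosines.
Otherwise split on the signs of `ta`, `tb`: for opposite signs each term is monotone, for equal
signs `exp_add_exp_le_of_le` trades one increment for the other. The alternatives list which indices
occupy the plus and minus slots. -/
lemma exp_contraction (x y φa φb ta tb : ℝ) (ha : |φa| ≤ |ta|) (hb : |φb| ≤ |tb|)
    (hab : |φa - φb| ≤ |ta - tb|) :
    Real.exp (x + φa) + Real.exp (y - φb) ≤ Real.exp (x + ta) + Real.exp (y - tb) ∨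
    Real.exp (x + φa) + Real.exp (y - φb) ≤ Real.exp (y + tb) + Real.exp (x - ta) ∨
    Real.exp (x + φa) + Real.exp (y - φb) ≤ Real.exp (x + ta) + Real.exp (x - ta) ∨
    Real.exp (x + φa) + Real.exp (y - φb) ≤ Real.exp (y + tb) + Real.exp (y - tb) := by
  have hcosh : ∀ x φ t : ℝ, |φ| ≤ |t| →
      Real.exp (x + φ) + Real.exp (x - φ) ≤ Real.exp (x + t) + Real.exp (x - t) := by
    intro x φ t h
    have := Real.cosh_le_cosh.2 h
    rw [Real.cosh_eq, Real.cosh_eq] at this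
    simp only [Real.exp_add, sub_eq_add_neg, ← mul_add]
    exact mul_le_mul_of_nonneg_left (by linarith) (Real.exp_nonneg x)
  rcases lt_or_ge (x + φa) (y + φb) with h1 | h1
  · right; right; right
    linarith [hcosh y φb tb hb, Real.exp_le_exp.2 h1.le]
  rcases lt_or_ge (y - φb) (x - φa) with h2 | h2
  · right; right; left
    linarith [hcosh x φa ta ha, Real.exp_le_exp.2 h2.le]
  have a1 := abs_le.1 ha
  have b1 := abs_le.1 hb
  have ab1 := abs_le.1 hab
  rcases le_total 0 ta with hta | hta <;> rcases le_total 0 tb with htb | htb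
  · rw [abs_of_nonneg hta] at a1
    rw [abs_of_nonneg htb] at b1
    rcases le_total tb ta with h | h
    · left
      rw [abs_of_nonneg (sub_nonneg.2 h)] at ab1
      have := exp_add_exp_le_of_le (P := x + φa) (Q := y - tb) (d₁ := tb - φb) (d₂ := ta - φa)
        (by linarith) (by linarith) (by linarith)
      ring_nf at this ⊢
      linarith
    · right; left
      rw [abs_of_nonpos (sub_nonpos.2 h)] at ab1
      have := exp_add_exp_le_of_le (P := y - φb) (Q := x - ta) (d₁ := φa + ta) (d₂ := tb + φb)
        (by linarith) (by linarith) (by linarith)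
      ring_nf at this ⊢
      linarith
  · left
    rw [abs_of_nonneg hta] at a1
    rw [abs_of_nonpos htb] at b1
    exact add_le_add (Real.exp_le_exp.2 (by linarith)) (Real.exp_le_exp.2 (by linarith))
  · right; left
    rw [abs_of_nonpos hta] at a1
    rw [abs_of_nonneg htb] at b1
    rw [add_comm (Real.exp (y + tb))]
    exact add_le_add (Real.exp_le_exp.2 (by linarith)) (Real.exp_le_exp.2 (by linarith))
  · rw [abs_of_nonpos hta] at a1
    rw [abs_of_nonpos htb] at b1
    rcases le_total ta tb with h | h
    · right; left
      rw [abs_of_nonpos (sub_nonpos.2 h)] at ab1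
      have := exp_add_exp_le_of_le (P := x + φa) (Q := y + tb) (d₁ := -tb - φb) (d₂ := -ta - φa)
        (by linarith) (by linarith) (by linarith)
      ring_nf at this ⊢
      linarith
    · left
      rw [abs_of_nonneg (sub_nonneg.2 h)] at ab1
      have := exp_add_exp_le_of_le (P := y - φb) (Q := x + ta) (d₁ := φa - ta) (d₂ := -tb + φb)
        (by linarith) (by linarith) (by linarith)
      ring_nf at this ⊢
      linarith

lemma expSup_contraction {ι : Type*} [Nonempty ι] (A φ t : ι → ℝ) (h0 : ∀ a, |φ a| ≤ |t a|)
    (h : ∀ a b, |φ a - φ b| ≤ |t a - t b|) :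
    expSup (fun a => A a + φ a) + expSup (fun a => A a - φ a) ≤
      expSup (fun a => A a + t a) + expSup (fun a => A a - t a) := by
  refine ENNReal.iSup_add_iSup_le fun a b => ?_
  have key : ∀ c d, Real.exp (A a + φ a) + Real.exp (A b - φ b) ≤
      Real.exp (A c + t c) + Real.exp (A d - t d) →
      ENNReal.ofReal (Real.exp (A a + φ a)) + ENNReal.ofReal (Real.exp (A b - φ b)) ≤
      expSup (fun a => A a + t a) + expSup (fun a => A a - t a) := by
    intro c d hcd
    rw [← ENNReal.ofReal_add (Real.exp_nonneg _) (Real.exp_nonneg _)]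
    refine (ENNReal.ofReal_le_ofReal hcd).trans ?_
    rw [ENNReal.ofReal_add (Real.exp_nonneg _) (Real.exp_nonneg _)]
    exact add_le_add (ofReal_exp_le_expSup (fun a => A a + t a) c)
      (ofReal_exp_le_expSup (fun a => A a - t a) d)
  rcases exp_contraction (A a) (A b) (φ a) (φ b) (t a) (t b) (h0 a) (h0 b) (h a b) with
    h' | h' | h' | h'
  exacts [key a b h', key b a h', key a a h', key b b h']

/-! ### Symmetrization in one coordinate -/

lemma ofReal_exp_integral_le {α : Type*} [MeasurableSpace α] {μ : Measure α}
    [IsProbabilityMeasure μ] {f : α → ℝ} (hf : Integrable f μ) :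
    ENNReal.ofReal (Real.exp (∫ z, f z ∂μ)) ≤ ∫⁻ z, ENNReal.ofReal (Real.exp (f z)) ∂μ := by
  set m := ∫ z, f z ∂μ with hm
  rcases eq_or_ne (∫⁻ z, ENNReal.ofReal (Real.exp (f z)) ∂μ) ⊤ with h | h
  · rw [h]; exact le_top
  have hmeas : AEStronglyMeasurable (fun z => Real.exp (f z)) μ :=
    Real.continuous_exp.comp_aestronglyMeasurable hf.1
  have hint : Integrable (fun z => Real.exp (f z)) μ := by
    refine ⟨hmeas, ?_⟩
    rw [hasFiniteIntegral_iff_ofReal (ae_of_all _ fun z => Real.exp_nonneg _)]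
    exact lt_top_iff_ne_top.2 h
  rw [← ofReal_integral_eq_lintegral_ofReal hint (ae_of_all _ fun z => Real.exp_nonneg _)]
  apply ENNReal.ofReal_le_ofReal
  have hlin : Integrable (fun z => Real.exp m * (1 - m) + Real.exp m * f z) μ :=
    (integrable_const _).add (hf.const_mul _)
  have h1 : ∫ z, (Real.exp m * (1 - m) + Real.exp m * f z) ∂μ = Real.exp m := by
    rw [integral_add (integrable_const _) (hf.const_mul _), integral_const_mul (Real.exp m) f, ← hm]
    simp
    ring
  rw [← h1]
  refine integral_mono hlin hint fun z => ?_
  have h2 := mul_le_mul_of_nonneg_left (Real.add_one_le_exp (f z - m)) (Real.exp_nonneg m)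
  rw [← Real.exp_add] at h2
  simp only [add_sub_cancel] at h2
  show Real.exp m * (1 - m) + Real.exp m * f z ≤ Real.exp (f z)
  linarith

lemma ofReal_exp_sub_le (A u v : ℝ) :
    ENNReal.ofReal (Real.exp (A + u - v)) ≤
      2⁻¹ * ENNReal.ofReal (Real.exp (A + 2 * u)) + 2⁻¹ * ENNReal.ofReal (Real.exp (A - 2 * v)) := by
  have h2 : (2⁻¹ : ℝ≥0∞) = ENNReal.ofReal 2⁻¹ := by
    rw [ENNReal.ofReal_inv_of_pos two_pos]; simp
  rw [h2, ← ENNReal.ofReal_mul (by norm_num), ← ENNReal.ofReal_mul (by norm_num),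
    ← ENNReal.ofReal_add (by positivity) (by positivity)]
  apply ENNReal.ofReal_le_ofReal
  have e1 : Real.exp (A + u - v) = Real.exp ((A + 2 * u) / 2) * Real.exp ((A - 2 * v) / 2) := by
    rw [← Real.exp_add]; congr 1; ring
  have e2 : Real.exp (A + 2 * u) = Real.exp ((A + 2 * u) / 2) ^ 2 := by
    rw [← Real.exp_nat_mul]; congr 1; push_cast; ring
  have e3 : Real.exp (A - 2 * v) = Real.exp ((A - 2 * v) / 2) ^ 2 := by
    rw [← Real.exp_nat_mul]; congr 1; push_cast; ring
  rw [e1, e2, e3]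
  nlinarith [sq_nonneg (Real.exp ((A + 2 * u) / 2) - Real.exp ((A - 2 * v) / 2))]

/-- Jensen replaces the mean by an independent copy `z'`, and the arithmetic-geometric inequality
separates `z` from `z'` at the price of a factor 2 in the exponent. -/
lemma expSup_sub_integral_le {ι α : Type*} [MeasurableSpace α] {μ : Measure α}
    [IsProbabilityMeasure μ] {g : α → ι → ℝ} (hg : ∀ a, Integrable (fun z => g z a) μ)
    (A : ι → ℝ) (z : α) :
    expSup (fun a => A a + (g z a - ∫ z', g z' a ∂μ)) ≤
      2⁻¹ * expSup (fun a => A a + 2 * g z a) +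
        2⁻¹ * ∫⁻ z', expSup (fun a => A a - 2 * g z' a) ∂μ := by
  refine iSup_le fun a => ?_
  have h1 : A a + (g z a - ∫ z', g z' a ∂μ) = ∫ z', A a + g z a - g z' a ∂μ := by
    rw [integral_sub (integrable_const _) (hg a)]
    simp
    ring
  beta_reduce
  rw [h1]
  refine (ofReal_exp_integral_le ((integrable_const _).sub (hg a))).trans ?_
  calc ∫⁻ z', ENNReal.ofReal (Real.exp (A a + g z a - g z' a)) ∂μ
      ≤ ∫⁻ z', 2⁻¹ * expSup (fun a => A a + 2 * g z a) +
          2⁻¹ * expSup (fun a => A a - 2 * g z' a) ∂μ := by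
        refine lintegral_mono fun z' => (ofReal_exp_sub_le _ _ _).trans ?_
        gcongr
        · exact ofReal_exp_le_expSup (fun a => A a + 2 * g z a) a
        · exact ofReal_exp_le_expSup (fun a => A a - 2 * g z' a) a
    _ = _ := by
        rw [lintegral_add_left measurable_const,
          lintegral_const_mul' 2⁻¹ (fun z' => expSup fun a => A a - 2 * g z' a) (by simp)]
        simp

/-- The sign `±1` attached to a Boolean. -/
def boolSign (b : Bool) : ℝ := if b then 1 else -1

/-- The product of `μ` with the uniform law on two signs. -/
def signProd {α : Type*} [MeasurableSpace α] (μ : Measure α) : Measure (α × Bool) :=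
  μ.prod ((2⁻¹ : ℝ≥0∞) • Measure.count)

instance {α : Type*} [MeasurableSpace α] (μ : Measure α) [IsProbabilityMeasure μ] :
    IsProbabilityMeasure (signProd μ) := by
  have : IsProbabilityMeasure ((2⁻¹ : ℝ≥0∞) • (Measure.count : Measure Bool)) := by
    refine ⟨?_⟩
    rw [Measure.smul_apply, Measure.count_univ]
    simp [ENNReal.inv_mul_cancel]
  unfold signProd
  infer_instance

lemma lintegral_signProd {α : Type*} [MeasurableSpace α] {μ : Measure α} [IsProbabilityMeasure μ]
    {f : α × Bool → ℝ≥0∞} (hf : Measurable f) :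
    ∫⁻ q, f q ∂(signProd μ) = 2⁻¹ * ∫⁻ z, (f (z, true) + f (z, false)) ∂μ := by
  unfold signProd
  rw [lintegral_prod _ hf.aemeasurable, ← lintegral_const_mul' _ _ (by simp)]
  refine lintegral_congr fun z => ?_
  rw [lintegral_smul_measure, lintegral_count, tsum_bool, add_comm, smul_eq_mul]

/-- Symmetrization and contraction in one coordinate. -/
lemma lintegral_expSup_le_signProd {ι α : Type*} [Nonempty ι] [Countable ι] [MeasurableSpace α]
    {μ : Measure α} [IsProbabilityMeasure μ] {g t : α → ι → ℝ}
    (hg : ∀ a, Integrable (fun z => g z a) μ) (hgm : ∀ a, Measurable fun z => g z a)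
    (htm : ∀ a, Measurable fun z => t z a)
    (h0 : ∀ z a, |g z a| ≤ |t z a|) (h : ∀ z a b, |g z a - g z b| ≤ |t z a - t z b|)
    (A : ι → ℝ) :
    ∫⁻ z, expSup (fun a => A a + (g z a - ∫ z', g z' a ∂μ)) ∂μ ≤
      ∫⁻ q, expSup (fun a => A a + boolSign q.2 * (2 * t q.1 a)) ∂(signProd μ) := by
  have hm1 : Measurable fun z => expSup (fun a => A a + 2 * g z a) :=
    measurable_expSup fun a => ((hgm a).const_mul 2).const_add _
  have hsign : Measurable fun q : α × Bool => boolSign q.2 :=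
    (measurable_of_countable boolSign).comp measurable_snd
  have hm2 : Measurable fun q : α × Bool => expSup (fun a => A a + boolSign q.2 * (2 * t q.1 a)) :=
    measurable_expSup fun a =>
      (hsign.mul (((htm a).comp measurable_fst).const_mul 2)).const_add _
  calc ∫⁻ z, expSup (fun a => A a + (g z a - ∫ z', g z' a ∂μ)) ∂μ
      ≤ ∫⁻ z, 2⁻¹ * expSup (fun a => A a + 2 * g z a) +
        2⁻¹ * ∫⁻ z', expSup (fun a => A a - 2 * g z' a) ∂μ ∂μ :=
        lintegral_mono fun z => expSup_sub_integral_le hg A z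
    _ = 2⁻¹ * ∫⁻ z, expSup (fun a => A a + 2 * g z a) + expSup (fun a => A a - 2 * g z a) ∂μ := by
        rw [lintegral_add_left (hm1.const_mul _), lintegral_const_mul' _ _ (by simp),
          lintegral_add_left hm1, mul_add]
        simp
    _ ≤ 2⁻¹ * ∫⁻ z, expSup (fun a => A a + 2 * t z a) + expSup (fun a => A a - 2 * t z a) ∂μ := by
        refine mul_le_mul_right (lintegral_mono fun z => ?_) _
        refine expSup_contraction A _ _ (fun a => ?_) fun a b => ?_
        · rw [abs_mul, abs_mul]
          exact mul_le_mul_of_nonneg_left (h0 z a) (abs_nonneg _)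
        · rw [← mul_sub, ← mul_sub, abs_mul, abs_mul]
          exact mul_le_mul_of_nonneg_left (h z a b) (abs_nonneg _)
    _ = _ := by
        rw [lintegral_signProd hm2]
        simp [boolSign, sub_eq_add_neg]

/-! ### Tensorization over the sample -/

lemma lintegral_pi_succ {α : Type*} [MeasurableSpace α] {μ : Measure α} [SigmaFinite μ] {n : ℕ}
    {f : (Fin (n + 1) → α) → ℝ≥0∞} (hf : Measurable f) :
    ∫⁻ z, f z ∂(Measure.pi fun _ => μ) =
      ∫⁻ z₀, ∫⁻ z, f (Fin.cons z₀ z) ∂(Measure.pi fun _ => μ) ∂μ := by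
  have hmp := (measurePreserving_piFinSuccAbove (fun _ : Fin (n + 1) => μ) 0).symm
  rw [← hmp.lintegral_comp hf]
  refine (lintegral_prod (μ := μ) (ν := Measure.pi fun _ : Fin n => μ)
    (fun z => f ((MeasurableEquiv.piFinSuccAbove (fun _ => α) 0).symm z))
    (hf.comp hmp.measurable).aemeasurable).trans ?_
  simp [MeasurableEquiv.piFinSuccAbove, Fin.insertNthEquiv]

lemma lintegral_pi_prod {α : Type*} [MeasurableSpace α] {μ : Measure α} [SigmaFinite μ]
    {f : α → ℝ≥0∞} (hf : Measurable f) (n : ℕ) :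
    ∫⁻ z, ∏ i, f (z i) ∂(Measure.pi fun _ : Fin n => μ) = (∫⁻ z, f z ∂μ) ^ n := by
  induction n with
  | zero => simp
  | succ n ih =>
    have hm : ∀ m : ℕ, Measurable fun z : Fin m → α => ∏ i, f (z i) := fun m =>
      Finset.measurable_prod _ fun i _ => hf.comp (measurable_pi_apply i)
    rw [lintegral_pi_succ (hm (n + 1))]
    have h : ∀ z₀, ∫⁻ z : Fin n → α, ∏ i, f ((Fin.cons z₀ z : Fin (n + 1) → α) i)
        ∂(Measure.pi fun _ => μ) = f z₀ * (∫⁻ z, f z ∂μ) ^ n := fun z₀ => by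
      rw [← ih, ← lintegral_const_mul _ (hm n)]
      exact lintegral_congr fun z => by simp [Fin.prod_univ_succ]
    simp only [h]
    rw [lintegral_mul_const _ hf, pow_succ']

/-- The one-coordinate hypothesis is required for every offset `A` precisely so that the sum over
the other coordinates can serve as an offset; Tonelli lets the coordinates be exchanged one at a
time. -/
lemma lintegral_expSup_pi_le {ι α β : Type*} [Countable ι] [MeasurableSpace α] [MeasurableSpace β]
    {μ : Measure α} {ρ : Measure β} [SigmaFinite μ] [SigmaFinite ρ] {g : α → ι → ℝ} {g' : β → ι → ℝ}
    (hg : ∀ a, Measurable fun z => g z a) (hg' : ∀ a, Measurable fun z => g' z a)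
    (h : ∀ A : ι → ℝ, ∫⁻ z, expSup (fun a => A a + g z a) ∂μ ≤
      ∫⁻ z, expSup (fun a => A a + g' z a) ∂ρ) (n : ℕ) (A : ι → ℝ) :
    ∫⁻ z, expSup (fun a => A a + ∑ i, g (z i) a) ∂(Measure.pi fun _ : Fin n => μ) ≤
      ∫⁻ z, expSup (fun a => A a + ∑ i, g' (z i) a) ∂(Measure.pi fun _ : Fin n => ρ) := by
  have hs : ∀ (m : ℕ) (a : ι), Measurable fun z : Fin m → α => ∑ i, g (z i) a := fun m a =>
    Finset.measurable_sum _ fun i _ => (hg a).comp (measurable_pi_apply i)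
  have hs' : ∀ (m : ℕ) (a : ι), Measurable fun z : Fin m → β => ∑ i, g' (z i) a := fun m a =>
    Finset.measurable_sum _ fun i _ => (hg' a).comp (measurable_pi_apply i)
  induction n generalizing A with
  | zero => simp
  | succ n ih =>
    rw [lintegral_pi_succ (measurable_expSup fun a => (hs (n + 1) a).const_add _),
      lintegral_pi_succ (measurable_expSup fun a => (hs' (n + 1) a).const_add _)]
    simp only [Fin.sum_univ_succ, Fin.cons_zero, Fin.cons_succ, ← add_assoc]
    calc ∫⁻ z₀, ∫⁻ z : Fin n → α, expSup (fun a => A a + g z₀ a + ∑ i, g (z i) a)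
          ∂(Measure.pi fun _ => μ) ∂μ
        ≤ ∫⁻ z₀, ∫⁻ z : Fin n → β, expSup (fun a => A a + g z₀ a + ∑ i, g' (z i) a)
          ∂(Measure.pi fun _ => ρ) ∂μ := lintegral_mono fun z₀ => ih _
      _ = ∫⁻ z : Fin n → β, ∫⁻ z₀, expSup (fun a => A a + g z₀ a + ∑ i, g' (z i) a) ∂μ
          ∂(Measure.pi fun _ => ρ) := by
        refine lintegral_lintegral_swap (Measurable.aemeasurable ?_)
        exact measurable_expSup fun a => (((hg a).comp measurable_fst).const_add _).add
          ((hs' n a).comp measurable_snd)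
      _ ≤ ∫⁻ z : Fin n → β, ∫⁻ z₀, expSup (fun a => A a + g' z₀ a + ∑ i, g' (z i) a) ∂ρ
          ∂(Measure.pi fun _ => ρ) := by
        refine lintegral_mono fun z => ?_
        have := h fun a => A a + ∑ i, g' (z i) a
        simpa only [add_right_comm] using this
      _ = _ := by
        refine lintegral_lintegral_swap (Measurable.aemeasurable ?_)
        exact measurable_expSup fun a => (((hg' a).comp measurable_snd).const_add _).add
          ((hs' n a).comp measurable_fst)

/-! ### Linear forms on an ℓ₁ ball -/

lemma abs_dotProduct_le {p : ℕ} {v u : Fin p → ℝ} {K : ℝ} (hv : ∀ j, |v j| ≤ K) :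
    |v ⬝ᵥ u| ≤ K * l1Norm u := by
  unfold dotProduct l1Norm
  rw [Finset.mul_sum]
  refine (Finset.abs_sum_le_sum_abs _ _).trans (Finset.sum_le_sum fun j _ => ?_)
  rw [abs_mul]
  exact mul_le_mul_of_nonneg_right (hv j) (abs_nonneg _)

/-- A linear form on the ball is at most its value at a vertex `±R eⱼ`; the maximum over the `2p`
vertices is replaced by a sum. -/
lemma exp_dotProduct_le {p : ℕ} (hp : 0 < p) {v u : Fin p → ℝ} {R : ℝ} (hu : l1Norm u ≤ R) :
    Real.exp (v ⬝ᵥ u) ≤ ∑ j, ∑ s : Bool, Real.exp (boolSign s * (R * v j)) := by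
  have : Nonempty (Fin p) := ⟨⟨0, hp⟩⟩
  obtain ⟨j, -, hj⟩ := Finset.exists_max_image Finset.univ (fun j => |v j|) Finset.univ_nonempty
  have h1 : v ⬝ᵥ u ≤ R * |v j| := by
    refine (le_abs_self _).trans ((abs_dotProduct_le fun i => hj i (Finset.mem_univ i)).trans ?_)
    rw [mul_comm]
    exact mul_le_mul_of_nonneg_right hu (abs_nonneg _)
  have h2 : Real.exp (v ⬝ᵥ u) ≤ ∑ s : Bool, Real.exp (boolSign s * (R * v j)) := by
    simp only [Fintype.sum_bool, boolSign, if_true, Bool.false_eq_true, if_false, one_mul, neg_mul]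
    refine (Real.exp_le_exp.2 h1).trans ?_
    rcases abs_choice (v j) with h | h <;> rw [h]
    · linarith [Real.exp_pos (-(R * v j))]
    · rw [mul_neg]; linarith [Real.exp_pos (R * v j)]
  exact h2.trans (Finset.single_le_sum
    (f := fun j => ∑ s : Bool, Real.exp (boolSign s * (R * v j)))
    (fun i _ => Finset.sum_nonneg fun s _ => Real.exp_nonneg _) (Finset.mem_univ j))

/-- Exponential moment of the supremum of an empirical process indexed by an `ℓ₁` ball, for a class
of Lipschitz transforms of linear forms. -/
lemma lintegral_expSup_empirical_le {ι α : Type*} [Nonempty ι] [Countable ι] [MeasurableSpace α]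
    {μ : Measure α} [IsProbabilityMeasure μ] {p : ℕ} (hp : 0 < p) {g : α → ι → ℝ}
    {v : α → Fin p → ℝ} {u : ι → Fin p → ℝ} {R : ℝ} {K : ℝ≥0∞} (hu : ∀ a, l1Norm (u a) ≤ R)
    (hg : ∀ a, Integrable (fun z => g z a) μ) (hgm : ∀ a, Measurable fun z => g z a)
    (hv : Measurable v)
    (h0 : ∀ z a, |g z a| ≤ |v z ⬝ᵥ u a|) (h : ∀ z a b, |g z a - g z b| ≤ |v z ⬝ᵥ (u a - u b)|)
    (hK : ∀ j, ∫⁻ z, ENNReal.ofReal (Real.cosh (2 * R * v z j)) ∂μ ≤ K) (n : ℕ) :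
    ∫⁻ z, expSup (fun a => ∑ i, (g (z i) a - ∫ z', g z' a ∂μ)) ∂(Measure.pi fun _ : Fin n => μ) ≤
      2 * p * K ^ n := by
  have hvj : ∀ j, Measurable fun z => v z j := fun j => (measurable_pi_apply j).comp hv
  have htm : ∀ a, Measurable fun z => v z ⬝ᵥ u a := fun a =>
    Finset.measurable_sum _ fun j _ => (hvj j).mul_const _
  have hsign : Measurable fun q : α × Bool => boolSign q.2 :=
    (measurable_of_countable boolSign).comp measurable_snd
  have step := lintegral_expSup_pi_le (μ := μ) (ρ := signProd μ)
    (g := fun z a => g z a - ∫ z', g z' a ∂μ)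
    (g' := fun q a => boolSign q.2 * (2 * (v q.1 ⬝ᵥ u a)))
    (fun a => (hgm a).sub_const _)
    (fun a => hsign.mul (((htm a).comp measurable_fst).const_mul 2))
    (fun A => lintegral_expSup_le_signProd hg hgm htm h0
      (fun z a b => by simpa only [dotProduct_sub] using h z a b) A) n 0
  simp only [Pi.zero_apply, zero_add] at step
  refine step.trans ?_
  let f : Fin p → Bool → α × Bool → ℝ≥0∞ := fun j s q =>
    ENNReal.ofReal (Real.exp (boolSign s * (R * (boolSign q.2 * (2 * v q.1 j)))))
  have hfm : ∀ j s, Measurable (f j s) := fun j s =>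
    (Real.measurable_exp.comp (((hsign.mul (((hvj j).comp measurable_fst).const_mul 2)).const_mul
      R).const_mul _)).ennreal_ofReal
  have hpt : ∀ z : Fin n → α × Bool,
      expSup (fun a => ∑ i, boolSign (z i).2 * (2 * (v (z i).1 ⬝ᵥ u a))) ≤
        ∑ j, ∑ s : Bool, ∏ i, f j s (z i) := by
    intro z
    refine iSup_le fun a => ?_
    have e : ∑ i, boolSign (z i).2 * (2 * (v (z i).1 ⬝ᵥ u a)) =
        (fun j => ∑ i, boolSign (z i).2 * (2 * v (z i).1 j)) ⬝ᵥ u a := by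
      simp only [dotProduct, Finset.mul_sum, Finset.sum_mul]
      rw [Finset.sum_comm]
      exact Finset.sum_congr rfl fun j _ => Finset.sum_congr rfl fun i _ => by ring
    beta_reduce
    rw [e]
    refine (ENNReal.ofReal_le_ofReal (exp_dotProduct_le hp (hu a))).trans (le_of_eq ?_)
    rw [ENNReal.ofReal_sum_of_nonneg fun j _ => Finset.sum_nonneg fun s _ => Real.exp_nonneg _]
    refine Finset.sum_congr rfl fun j _ => ?_
    rw [ENNReal.ofReal_sum_of_nonneg fun s _ => Real.exp_nonneg _]
    refine Finset.sum_congr rfl fun s _ => ?_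
    rw [Finset.mul_sum, Finset.mul_sum, Real.exp_sum,
      ENNReal.ofReal_prod_of_nonneg fun i _ => Real.exp_nonneg _]
  -- Averaging over the symmetrizing sign turns each exponential into the hyperbolic cosine of `hK`.
  have hfK : ∀ j s, ∫⁻ q, f j s q ∂(signProd μ) ≤ K := by
    intro j s
    refine le_trans (le_of_eq ?_) (hK j)
    rw [lintegral_signProd (hfm j s), ← lintegral_const_mul' _ _ (by simp)]
    refine lintegral_congr fun z => ?_
    have h2 : (2⁻¹ : ℝ≥0∞) = ENNReal.ofReal 2⁻¹ := by
      rw [ENNReal.ofReal_inv_of_pos two_pos]; simp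
    rw [← ENNReal.ofReal_add (Real.exp_nonneg _) (Real.exp_nonneg _), h2,
      ← ENNReal.ofReal_mul (by norm_num), Real.cosh_eq]
    congr 1
    cases s <;> simp [boolSign] <;> ring_nf
  calc _ ≤ ∫⁻ z, ∑ j, ∑ s : Bool, ∏ i, f j s (z i)
          ∂(Measure.pi fun _ : Fin n => signProd μ) := lintegral_mono hpt
    _ = ∑ j, ∑ s : Bool, (∫⁻ q, f j s q ∂(signProd μ)) ^ n := by
        have hm : ∀ j s, Measurable fun z : Fin n → α × Bool => ∏ i, f j s (z i) := fun j s =>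
          Finset.measurable_prod _ fun i _ => (hfm j s).comp (measurable_pi_apply i)
        rw [lintegral_finsetSum _ fun j _ => Finset.measurable_sum _ fun s _ => hm j s]
        refine Finset.sum_congr rfl fun j _ => ?_
        rw [lintegral_finsetSum _ fun s _ => hm j s]
        exact Finset.sum_congr rfl fun s _ => lintegral_pi_prod (hfm j s) n
    _ ≤ ∑ _j : Fin p, ∑ _s : Bool, K ^ n :=
        Finset.sum_le_sum fun j _ => Finset.sum_le_sum fun s _ => pow_le_pow_left' (hfK j s) n
    _ = 2 * p * K ^ n := by
        simp
        ring

/-! ### The loss: Lipschitz bound, convexity, curvature -/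

/-- The negative log-likelihood (up to an additive constant) of the response `y` at the linear
predictor `t`. -/
def loss (θ t : ℝ) (y : ℕ) : ℝ := -(y * t) + (θ + y) * Real.log (θ + Real.exp t)

lemma hasDerivAt_log_add_exp {θ : ℝ} (hθ : 0 < θ) (t : ℝ) :
    HasDerivAt (fun t => Real.log (θ + Real.exp t)) (Real.exp t / (θ + Real.exp t)) t :=
  ((Real.hasDerivAt_exp t).const_add θ).log (by positivity)

lemma log_add_exp_sub_mem {θ s t : ℝ} (hθ : 0 < θ) (h : s ≤ t) :
    0 ≤ Real.log (θ + Real.exp t) - Real.log (θ + Real.exp s) ∧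
      Real.log (θ + Real.exp t) - Real.log (θ + Real.exp s) ≤ t - s := by
  have hst := Real.exp_le_exp.2 h
  constructor
  · rw [sub_nonneg]
    exact Real.log_le_log (by positivity) (by linarith)
  · rw [sub_le_iff_le_add]
    have h1 : θ + Real.exp t ≤ Real.exp (t - s) * (θ + Real.exp s) := by
      rw [mul_add, ← Real.exp_add, sub_add_cancel]
      have := Real.one_le_exp (sub_nonneg.2 h)
      nlinarith
    calc _ ≤ Real.log (Real.exp (t - s) * (θ + Real.exp s)) :=
          Real.log_le_log (by positivity) h1
      _ = _ := by rw [Real.log_mul (by positivity) (by positivity), Real.log_exp]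

/-- The derivative of the loss in `t` lies between `-y` and `θ`. -/
lemma abs_loss_sub_le {θ : ℝ} (hθ : 0 < θ) (s t : ℝ) (y : ℕ) :
    |loss θ t y - loss θ s y| ≤ max (y : ℝ) θ * |t - s| := by
  wlog h : s ≤ t generalizing s t
  · rw [abs_sub_comm, abs_sub_comm t]
    exact this t s (le_of_not_ge h)
  obtain ⟨h1, h2⟩ := log_add_exp_sub_mem hθ h
  rw [abs_of_nonneg (sub_nonneg.2 h)]
  have hy : (0 : ℝ) ≤ y := Nat.cast_nonneg y
  have e : loss θ t y - loss θ s y = -(y * (t - s)) +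
      (θ + y) * (Real.log (θ + Real.exp t) - Real.log (θ + Real.exp s)) := by
    unfold loss; ring
  rw [e, abs_le]
  have m1 := mul_le_mul_of_nonneg_right (le_max_left (y : ℝ) θ) (sub_nonneg.2 h)
  have m2 := mul_le_mul_of_nonneg_right (le_max_right (y : ℝ) θ) (sub_nonneg.2 h)
  have m3 := mul_le_mul_of_nonneg_left h2 (show 0 ≤ θ + y by positivity)
  have m4 := mul_nonneg (show 0 ≤ θ + y by positivity) h1
  constructor <;> linarith

/-- Convexity of `exp` between 0 and `t - s` with weight `q`, followed by the logarithm. -/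
lemma log_add_exp_tangent {θ : ℝ} (hθ : 0 < θ) (s t : ℝ) :
    Real.exp s / (θ + Real.exp s) * (t - s) ≤
      Real.log (θ + Real.exp t) - Real.log (θ + Real.exp s) := by
  set q := Real.exp s / (θ + Real.exp s) with hq
  have hq0 : 0 ≤ q := by positivity
  have hq1 : q ≤ 1 := by rw [hq, div_le_one (by positivity)]; linarith
  have hconv := convexOn_exp.2 (Set.mem_univ 0) (Set.mem_univ (t - s)) (sub_nonneg.2 hq1) hq0
    (by ring)
  simp only [smul_eq_mul, mul_zero, zero_add, Real.exp_zero, mul_one] at hconv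
  rw [← Real.log_div (by positivity) (by positivity), Real.le_log_iff_exp_le (by positivity)]
  refine hconv.trans (le_of_eq ?_)
  rw [hq, Real.exp_sub]
  field_simp
  ring

/-- The derivative of `loss θ · y` at `t`. -/
def lossDeriv (θ t : ℝ) (y : ℕ) : ℝ := -((y - Real.exp t) * (θ / (θ + Real.exp t)))

lemma loss_tangent {θ : ℝ} (hθ : 0 < θ) (s t : ℝ) (y : ℕ) :
    lossDeriv θ s y * (t - s) ≤ loss θ t y - loss θ s y := by
  have h := mul_le_mul_of_nonneg_left (log_add_exp_tangent hθ s t)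
    (show (0 : ℝ) ≤ θ + y by positivity)
  have e : lossDeriv θ s y = -(y : ℝ) + (θ + y) * (Real.exp s / (θ + Real.exp s)) := by
    unfold lossDeriv
    have := Real.exp_pos s
    field_simp
    ring
  rw [e]
  unfold loss
  linarith

lemma loss_segment_le {θ : ℝ} (hθ : 0 < θ) (b d : ℝ) (y : ℕ) {s : ℝ} (hs0 : 0 ≤ s) (hs1 : s ≤ 1) :
    loss θ (b + s * d) y ≤ (1 - s) * loss θ b y + s * loss θ (b + d) y := by
  have h1 := mul_le_mul_of_nonneg_left (loss_tangent hθ (b + s * d) b y) (sub_nonneg.2 hs1)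
  have h2 := mul_le_mul_of_nonneg_left (loss_tangent hθ (b + s * d) (b + d) y) hs0
  linarith

/-- Apply the mean value theorem twice to `G` minus the parabola `a (u - y)²`, which has
nondecreasing slope on the window and slope zero at `y`. -/
lemma quadratic_lower_bound {G G' G'' : ℝ → ℝ} (h1 : ∀ t, HasDerivAt G (G' t) t)
    (h2 : ∀ t, HasDerivAt G' (G'' t) t) {K a y t : ℝ} (hy : |y| ≤ K) (ht : |t| ≤ K)
    (h0 : G' y = 0) (ha : ∀ u, |u| ≤ K → 2 * a ≤ G'' u) :
    G y + a * (t - y) ^ 2 ≤ G t := by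
  have H1 : ∀ u, HasDerivAt (fun u => G u - a * (u - y) ^ 2) (G' u - 2 * a * (u - y)) u := by
    intro u
    refine ((h1 u).sub ((((hasDerivAt_id' u).sub_const y).pow 2).const_mul a)).congr_deriv ?_
    push_cast
    ring
  have H2 : ∀ u, HasDerivAt (fun u => G' u - 2 * a * (u - y)) (G'' u - 2 * a) u := by
    intro u
    refine ((h2 u).sub (((hasDerivAt_id' u).sub_const y).const_mul (2 * a))).congr_deriv ?_
    ring
  have hcont : ∀ {F F' : ℝ → ℝ}, (∀ u, HasDerivAt F (F' u) u) → ∀ s, ContinuousOn F s :=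
    fun h s u _ => (h u).continuousAt.continuousWithinAt
  rw [abs_le] at hy ht
  rcases lt_trichotomy y t with hlt | heq | hlt
  · obtain ⟨c, hc, hc'⟩ := exists_hasDerivAt_eq_slope _ _ hlt (hcont H1 _) fun u _ => H1 u
    obtain ⟨d, hd, hd'⟩ := exists_hasDerivAt_eq_slope _ _ hc.1 (hcont H2 _) fun u _ => H2 u
    have hd2 := ha d (abs_le.2 ⟨by linarith [hd.1], by linarith [hd.2, hc.2]⟩)
    rw [eq_div_iff (by linarith [hc.1])] at hd'
    rw [eq_div_iff (by linarith)] at hc'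
    have := mul_nonneg (sub_nonneg.2 hd2) (sub_nonneg.2 hc.1.le)
    have h3 : 0 ≤ G' c - 2 * a * (c - y) := by
      simp only [h0, sub_self, mul_zero] at hd'
      linarith
    have := mul_nonneg h3 (sub_nonneg.2 hlt.le)
    simp only [sub_self] at hc'
    linarith
  · subst heq; simp
  · obtain ⟨c, hc, hc'⟩ := exists_hasDerivAt_eq_slope _ _ hlt (hcont H1 _) fun u _ => H1 u
    obtain ⟨d, hd, hd'⟩ := exists_hasDerivAt_eq_slope _ _ hc.2 (hcont H2 _) fun u _ => H2 u
    have hd2 := ha d (abs_le.2 ⟨by linarith [hd.1, hc.1], by linarith [hd.2]⟩)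
    rw [eq_div_iff (by linarith [hc.2])] at hd'
    rw [eq_div_iff (by linarith)] at hc'
    have := mul_nonneg (sub_nonneg.2 hd2) (sub_nonneg.2 hc.2.le)
    have h3 : G' c - 2 * a * (c - y) ≤ 0 := by
      simp only [h0, sub_self, mul_zero] at hd'
      linarith
    have := mul_nonneg (neg_nonneg.2 h3) (sub_nonneg.2 hlt.le)
    simp only [sub_self] at hc'
    linarith

lemma curvConst_le {θ L B M x y : ℝ} (hθ : 0 < θ) (hx : |x| ≤ L * (M + B)) (hy : |y| ≤ L * B) :
    curvConst θ L B M ≤ 1 / 2 * (θ * Real.exp x * (Real.exp y + θ) / (θ + Real.exp x) ^ 2) :=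
  csInf_le ⟨0, by rintro _ ⟨q, -, rfl⟩; positivity⟩ ⟨(x, y), ⟨hx, hy⟩, rfl⟩

lemma curvConst_pos {θ L B M : ℝ} (hθ : 0 < θ) (hL : 0 ≤ L) (hB : 0 ≤ B) (hM : 0 ≤ M) :
    0 < curvConst θ L B M := by
  set K := L * (M + B) with hK
  have hpos : 0 < 1 / 2 * (θ * Real.exp (-K) * θ / (θ + Real.exp K) ^ 2) := by positivity
  refine hpos.trans_le (le_csInf ⟨_, (0, 0), ⟨by simp; positivity, by simp; positivity⟩, rfl⟩ ?_)
  rintro _ ⟨⟨x, y⟩, ⟨hx, -⟩, rfl⟩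
  have h1 := Real.exp_le_exp.2 (abs_le.1 hx).1
  have h2 := Real.exp_le_exp.2 (abs_le.1 hx).2
  have h3 := Real.exp_pos y
  dsimp only at *
  gcongr
  linarith

/-- The conditional mean is `exp s`, so `s` is a critical point of the conditional risk; its second
derivative is twice the expression minimised in `curvConst`. -/
lemma condRisk_curvature {θ L B M s t : ℝ} (hθ : 0 < θ) (hL : 0 ≤ L) (hM : 0 ≤ M)
    (hs : |s| ≤ L * B) (ht : |t| ≤ L * (M + B)) :
    curvConst θ L B M * (t - s) ^ 2 ≤
      (-(Real.exp s * t) + (θ + Real.exp s) * Real.log (θ + Real.exp t)) -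
      (-(Real.exp s * s) + (θ + Real.exp s) * Real.log (θ + Real.exp s)) := by
  have hpos : ∀ u, θ + Real.exp u ≠ 0 := fun u => by positivity
  have := quadratic_lower_bound
    (G := fun t => -(Real.exp s * t) + (θ + Real.exp s) * Real.log (θ + Real.exp t))
    (G' := fun t => -Real.exp s + (θ + Real.exp s) * (Real.exp t / (θ + Real.exp t)))
    (G'' := fun t => (θ + Real.exp s) * (θ * Real.exp t / (θ + Real.exp t) ^ 2))
    (K := L * (M + B)) (a := curvConst θ L B M) (y := s) (t := t) ?_ ?_ ?_ ht ?_ ?_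
  · linarith
  · intro t
    refine ((((hasDerivAt_id' t).const_mul (Real.exp s)).neg).add
      ((hasDerivAt_log_add_exp hθ t).const_mul (θ + Real.exp s))).congr_deriv ?_
    ring
  · intro t
    refine ((((Real.hasDerivAt_exp t).div ((Real.hasDerivAt_exp t).const_add θ) (hpos t)).const_mul
      (θ + Real.exp s)).const_add (-Real.exp s)).congr_deriv ?_
    ring
  · nlinarith [mul_nonneg hL hM]
  · field_simp [hpos s]
    simp
  · intro u hu
    have := curvConst_le hθ hu hs
    have e : (θ + Real.exp s) * (θ * Real.exp u / (θ + Real.exp u) ^ 2) =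
      θ * Real.exp u * (Real.exp s + θ) / (θ + Real.exp u) ^ 2 := by ring
    rw [e]
    linarith

/-! ### The population model: risk and exponential moments -/

/-- The conditional laws `κ x` of the response have means `exp (xᵀ β)` and satisfy moment bounds
with constant `C`, the covariates are bounded by `L` and the linear predictors by `K`. -/
structure IsCountModel {p : ℕ} (ν : Measure (Fin p → ℝ)) (κ : Kernel (Fin p → ℝ) ℕ)
    (β : Fin p → ℝ) (L K C : ℝ) : Prop where
  bdd : ∀ᵐ x ∂ν, ∀ j, |x j| ≤ L
  pred : ∀ᵐ x ∂ν, |x ⬝ᵥ β| ≤ K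
  moment : ∀ᵐ x ∂ν, HasMomentBound (κ x) C
  mean : ∀ᵐ x ∂ν, ∫⁻ y, ENNReal.ofReal (y : ℝ) ∂(κ x) = ENNReal.ofReal (Real.exp (x ⬝ᵥ β))

section Model

variable {p : ℕ} {ν : Measure (Fin p → ℝ)} [IsProbabilityMeasure ν] {κ : Kernel (Fin p → ℝ) ℕ}
  [IsMarkovKernel κ] {β : Fin p → ℝ} {θ L K C : ℝ}

lemma lintegral_compProd_le {f : (Fin p → ℝ) × ℕ → ℝ≥0∞} (hf : Measurable f) {c : ℝ≥0∞}
    (h : ∀ᵐ x ∂ν, ∫⁻ y, f (x, y) ∂(κ x) ≤ c) : ∫⁻ z, f z ∂(ν ⊗ₘ κ) ≤ c := by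
  rw [Measure.lintegral_compProd hf]
  calc _ ≤ ∫⁻ _, c ∂ν := lintegral_mono_ae h
    _ = c := by simp

lemma ae_compProd_of_ae_fst {P : (Fin p → ℝ) → Prop} (h : ∀ᵐ x ∂ν, P x) :
    ∀ᵐ z ∂(ν ⊗ₘ κ), P z.1 := by
  have h' : ∀ᵐ x ∂(ν ⊗ₘ κ).fst, P x := by rwa [Measure.fst_compProd]
  exact ae_of_ae_map measurable_fst.aemeasurable h'

lemma measurable_natCast_snd : Measurable fun z : (Fin p → ℝ) × ℕ => (z.2 : ℝ) :=
  (measurable_of_countable (fun y : ℕ => (y : ℝ))).comp measurable_snd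

lemma measurable_dotProduct (u : Fin p → ℝ) : Measurable fun x : Fin p → ℝ => x ⬝ᵥ u :=
  Finset.measurable_sum _ fun j _ => (measurable_pi_apply j).mul_const _

lemma measurable_loss {α : Type*} [MeasurableSpace α] {f : α → ℝ} {g : α → ℕ} (θ : ℝ)
    (hf : Measurable f) (hg : Measurable g) : Measurable fun z => loss θ (f z) (g z) := by
  have hg' : Measurable fun z => (g z : ℝ) := (measurable_of_countable (fun y : ℕ => (y : ℝ))).comp hg
  exact (hg'.mul hf).neg.add ((hg'.const_add θ).mul
    (Real.measurable_log.comp ((Real.measurable_exp.comp hf).const_add θ)))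

lemma IsCountModel.integrable_snd (h : IsCountModel ν κ β L K C) :
    Integrable (fun z : (Fin p → ℝ) × ℕ => (z.2 : ℝ)) (ν ⊗ₘ κ) := by
  refine ⟨measurable_natCast_snd.aestronglyMeasurable, ?_⟩
  rw [hasFiniteIntegral_iff_ofReal (ae_of_all _ fun z => Nat.cast_nonneg _)]
  refine lt_of_le_of_lt (lintegral_compProd_le measurable_natCast_snd.ennreal_ofReal
    (c := ENNReal.ofReal (Nat.factorial 1 * C ^ 1)) ?_) ENNReal.ofReal_lt_top
  filter_upwards [h.moment] with x hx
  simpa using hx 1 le_rfl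

/-- The increment of the loss from `β` to `β + δ`. -/
def lossIncr (θ : ℝ) (β δ : Fin p → ℝ) (z : (Fin p → ℝ) × ℕ) : ℝ :=
  loss θ (z.1 ⬝ᵥ (β + δ)) z.2 - loss θ (z.1 ⬝ᵥ β) z.2

lemma measurable_lossIncr (θ : ℝ) (β δ : Fin p → ℝ) : Measurable (lossIncr θ β δ) :=
  (measurable_loss θ ((measurable_dotProduct _).comp measurable_fst) measurable_snd).sub
    (measurable_loss θ ((measurable_dotProduct _).comp measurable_fst) measurable_snd)

lemma abs_lossIncr_sub_le (hθ : 0 < θ) (β δ δ' : Fin p → ℝ) (z : (Fin p → ℝ) × ℕ) :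
    |lossIncr θ β δ z - lossIncr θ β δ' z| ≤ max (z.2 : ℝ) θ * |z.1 ⬝ᵥ (δ - δ')| := by
  have := abs_loss_sub_le hθ (z.1 ⬝ᵥ (β + δ')) (z.1 ⬝ᵥ (β + δ)) z.2
  have e : z.1 ⬝ᵥ (δ - δ') = z.1 ⬝ᵥ (β + δ) - z.1 ⬝ᵥ (β + δ') := by
    rw [dotProduct_sub, dotProduct_add, dotProduct_add]; ring
  unfold lossIncr
  rw [e]
  convert this using 2
  ring

lemma lossIncr_zero (θ : ℝ) (β : Fin p → ℝ) (z : (Fin p → ℝ) × ℕ) : lossIncr θ β 0 z = 0 := by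
  simp [lossIncr]

lemma abs_lossIncr_le (hθ : 0 < θ) (β δ : Fin p → ℝ) (z : (Fin p → ℝ) × ℕ) :
    |lossIncr θ β δ z| ≤ max (z.2 : ℝ) θ * |z.1 ⬝ᵥ δ| := by
  simpa [lossIncr_zero] using abs_lossIncr_sub_le hθ β δ 0 z

lemma IsCountModel.ae_abs_lossIncr_sub_le (h : IsCountModel ν κ β L K C) (hθ : 0 < θ)
    (δ δ' : Fin p → ℝ) :
    ∀ᵐ z ∂(ν ⊗ₘ κ), |lossIncr θ β δ z - lossIncr θ β δ' z| ≤
      (z.2 + θ) * (L * l1Norm (δ - δ')) := by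
  filter_upwards [ae_compProd_of_ae_fst (κ := κ) h.bdd] with z hz
  refine (abs_lossIncr_sub_le hθ β δ δ' z).trans ?_
  have h1 := abs_dotProduct_le (u := δ - δ') hz
  have hy : (0 : ℝ) ≤ z.2 := Nat.cast_nonneg _
  have h2 : max (z.2 : ℝ) θ ≤ z.2 + θ := max_le (by linarith) (by linarith)
  exact mul_le_mul h2 h1 (abs_nonneg _) (by positivity)

lemma IsCountModel.integrable_lossIncr (h : IsCountModel ν κ β L K C) (hθ : 0 < θ)
    (δ : Fin p → ℝ) : Integrable (lossIncr θ β δ) (ν ⊗ₘ κ) := by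
  refine Integrable.mono' ((h.integrable_snd.add (integrable_const θ)).mul_const
    (L * l1Norm (δ - 0))) (measurable_lossIncr θ β δ).aestronglyMeasurable ?_
  filter_upwards [h.ae_abs_lossIncr_sub_le hθ δ 0] with z hz
  simpa [lossIncr_zero] using hz

lemma integrable_sq_dotProduct (hbdd : ∀ᵐ x ∂ν, ∀ j, |x j| ≤ L) (δ : Fin p → ℝ) :
    Integrable (fun x => (x ⬝ᵥ δ) ^ 2) ν := by
  refine Integrable.mono' (integrable_const ((L * l1Norm δ) ^ 2))
    ((measurable_dotProduct δ).pow_const 2).aestronglyMeasurable ?_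
  filter_upwards [hbdd] with x hx
  rw [Real.norm_eq_abs, abs_pow]
  exact pow_le_pow_left₀ (abs_nonneg _) (abs_dotProduct_le hx) 2

/-- Integrate the conditional bound over the design. The restriction to radius `M` keeps the linear
predictor inside the window defining `curvConst`. -/
lemma IsCountModel.curvature {B M : ℝ} (h : IsCountModel ν κ β L (L * B) C) (hθ : 0 < θ)
    (hL : 0 ≤ L) (hM : 0 ≤ M) {δ : Fin p → ℝ} (hδ : l1Norm δ ≤ M) :
    curvConst θ L B M * ∫ x, (x ⬝ᵥ δ) ^ 2 ∂ν ≤ ∫ z, lossIncr θ β δ z ∂(ν ⊗ₘ κ) := by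
  have hint := h.integrable_lossIncr hθ δ
  rw [Measure.integral_compProd hint, ← integral_const_mul]
  refine integral_mono_ae ((integrable_sq_dotProduct h.bdd δ).const_mul _)
    (Integrable.integral_compProd (κ := Kernel.const Unit ν) (η := Kernel.prodMkLeft Unit κ)
      (a := ()) hint) ?_
  filter_upwards [h.bdd, h.pred, h.mean] with x hx hpred hmean
  have hy := integral_natCast_of_lintegral (Real.exp_nonneg _) hmean
  have hyi := integrable_natCast_of_lintegral hmean
  have hd := (abs_dotProduct_le (u := δ) hx).trans (mul_le_mul_of_nonneg_left hδ hL)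
  have ht : |x ⬝ᵥ (β + δ)| ≤ L * (M + B) := by
    rw [dotProduct_add]
    exact (abs_add_le _ _).trans (by linarith)
  have hcurv := condRisk_curvature hθ hL hM hpred ht
  set s := x ⬝ᵥ β with hs
  set t := x ⬝ᵥ (β + δ) with ht'
  have hts : t - s = x ⬝ᵥ δ := by rw [ht', hs, dotProduct_add]; ring
  rw [hts] at hcurv
  refine hcurv.trans (le_of_eq ?_)
  have e : ∀ y : ℕ, lossIncr θ β δ (x, y) =
      (y : ℝ) * (-(t - s) + (Real.log (θ + Real.exp t) - Real.log (θ + Real.exp s))) +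
        θ * (Real.log (θ + Real.exp t) - Real.log (θ + Real.exp s)) := by
    intro y
    simp only [lossIncr, loss, ← hs, ← ht']
    ring
  simp only [e]
  rw [integral_add (hyi.mul_const _) (integrable_const _), integral_mul_const, hy]
  simp only [integral_const, probReal_univ, smul_eq_mul, one_mul]
  ring

/-- The maximum is one of its two arguments; the constant 1 is charged to the `θ` part only, so the
resulting exponent is quadratic in `q`. -/
lemma lintegral_cosh_max_le {κ : Measure ℕ} [IsProbabilityMeasure κ] {C q θ : ℝ} (hC : 0 ≤ C)
    (hκ : HasMomentBound κ C) (hq : 0 ≤ q) (hqC : q * C < 1) :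
    ∫⁻ y : ℕ, ENNReal.ofReal (Real.cosh (q * max (y : ℝ) θ)) ∂κ ≤
      ENNReal.ofReal (Real.exp ((q * C) ^ 2 / (1 - q * C) + (q * θ) ^ 2 / 2)) := by
  set b := (q * C) ^ 2 / (1 - q * C) with hb
  have hb0 : 0 ≤ b := div_nonneg (by positivity) (by linarith)
  have hpt : ∀ y : ℕ, Real.cosh (q * max (y : ℝ) θ) ≤
      expRem (q * y) + Real.cosh (q * θ) := by
    intro y
    have h1 := cosh_le_one_add_expRem (u := q * y) (by positivity)
    have h2 := Real.one_le_cosh (q * θ)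
    have h3 := expRem_nonneg (q * y)
    rcases max_choice (y : ℝ) θ with h | h <;> rw [h] <;> linarith
  calc _ ≤ ∫⁻ y : ℕ, ENNReal.ofReal (expRem (q * y)) + ENNReal.ofReal (Real.cosh (q * θ)) ∂κ := by
        refine lintegral_mono fun y => ?_
        rw [← ENNReal.ofReal_add (expRem_nonneg _) (Real.cosh_pos _).le]
        exact ENNReal.ofReal_le_ofReal (hpt y)
    _ = ∫⁻ y : ℕ, ENNReal.ofReal (expRem (q * y)) ∂κ + ENNReal.ofReal (Real.cosh (q * θ)) := by
        rw [lintegral_add_left (measurable_of_countable _)]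
        simp
    _ ≤ ENNReal.ofReal b + ENNReal.ofReal (Real.cosh (q * θ)) := by
        gcongr
        exact lintegral_expRem_le hC hκ hq hqC
    _ ≤ _ := by
        rw [← ENNReal.ofReal_add hb0 (Real.cosh_pos _).le]
        apply ENNReal.ofReal_le_ofReal
        have h1 := Real.cosh_le_exp_half_sq (q * θ)
        have h2 : 1 ≤ Real.exp ((q * θ) ^ 2 / 2) := Real.one_le_exp (by positivity)
        have h3 := Real.add_one_le_exp b
        rw [Real.exp_add]
        nlinarith

lemma IsCountModel.lintegral_cosh_le (h : IsCountModel ν κ β L K C) (hL : 0 ≤ L) (hC : 0 ≤ C)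
    (hθ : 0 ≤ θ) {c : ℝ} (hc : 0 ≤ c) (hcC : c * L * C < 1) (j : Fin p) :
    ∫⁻ z, ENNReal.ofReal (Real.cosh (c * (max (z.2 : ℝ) θ * z.1 j))) ∂(ν ⊗ₘ κ) ≤
      ENNReal.ofReal (Real.exp ((c * L * C) ^ 2 / (1 - c * L * C) + (c * L * θ) ^ 2 / 2)) := by
  have hm : Measurable fun z : (Fin p → ℝ) × ℕ => c * (max (z.2 : ℝ) θ * z.1 j) :=
    ((measurable_natCast_snd.max measurable_const).mul
      ((measurable_pi_apply j).comp measurable_fst)).const_mul c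
  refine lintegral_compProd_le (Real.continuous_cosh.measurable.comp hm).ennreal_ofReal ?_
  filter_upwards [h.bdd, h.moment] with x hx hmom
  refine le_trans (lintegral_mono fun y => ENNReal.ofReal_le_ofReal ?_)
    (lintegral_cosh_max_le hC hmom (mul_nonneg hc hL) hcC)
  refine Real.cosh_le_cosh.2 ?_
  have hmax : 0 ≤ max (y : ℝ) θ := hθ.trans (le_max_right _ _)
  rw [abs_mul, abs_mul, abs_of_nonneg hc, abs_of_nonneg hmax,
    abs_of_nonneg (by positivity : 0 ≤ c * L * max (y : ℝ) θ), mul_assoc, mul_comm L]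
  gcongr
  exact hx j

lemma measurable_lossDeriv {α : Type*} [MeasurableSpace α] {f : α → ℝ} {g : α → ℕ} (θ : ℝ)
    (hf : Measurable f) (hg : Measurable g) : Measurable fun z => lossDeriv θ (f z) (g z) := by
  have hg' : Measurable fun z => (g z : ℝ) := (measurable_of_countable (fun y : ℕ => (y : ℝ))).comp hg
  have he := Real.measurable_exp.comp hf
  exact ((hg'.sub he).mul (measurable_const.div (he.const_add θ))).neg

/-- The `j`-th coordinate of the score at `β`. -/
def score (θ : ℝ) (β : Fin p → ℝ) (j : Fin p) (z : (Fin p → ℝ) × ℕ) : ℝ :=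
  lossDeriv θ (z.1 ⬝ᵥ β) z.2 * z.1 j

lemma measurable_score (θ : ℝ) (β : Fin p → ℝ) (j : Fin p) : Measurable (score θ β j) :=
  (measurable_lossDeriv θ ((measurable_dotProduct β).comp measurable_fst) measurable_snd).mul
    ((measurable_pi_apply j).comp measurable_fst)

lemma IsCountModel.lintegral_exp_score_le (h : IsCountModel ν κ β L K C) (hC : 0 ≤ C)
    (hθ : 0 < θ) {c : ℝ} (hcC : |c| * L * C < 1) (j : Fin p) :
    ∫⁻ z, ENNReal.ofReal (Real.exp (c * score θ β j z)) ∂(ν ⊗ₘ κ) ≤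
      ENNReal.ofReal (Real.exp ((|c| * L * C) ^ 2 / (1 - |c| * L * C))) := by
  refine lintegral_compProd_le
    (Real.measurable_exp.comp ((measurable_score θ β j).const_mul c)).ennreal_ofReal ?_
  filter_upwards [h.bdd, h.moment, h.mean] with x hx hmom hmean
  set μ := Real.exp (x ⬝ᵥ β) with hμ
  have hμ0 : 0 < μ := Real.exp_pos _
  set w := -(c * (θ / (θ + μ)) * x j) with hw
  have hw1 : |w| ≤ |c| * L := by
    have h1 : θ / (θ + μ) ≤ 1 := by rw [div_le_one (by positivity)]; linarith
    rw [hw, abs_neg, abs_mul, abs_mul, abs_of_nonneg (by positivity : 0 ≤ θ / (θ + μ))]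
    calc |c| * (θ / (θ + μ)) * |x j| ≤ |c| * 1 * L := by
          gcongr
          exact hx j
      _ = _ := by ring
  have hwC : |w| * C ≤ |c| * L * C := mul_le_mul_of_nonneg_right hw1 hC
  have e : ∀ y : ℕ, c * score θ β j (x, y) = w * (y - μ) := by
    intro y
    simp only [score, lossDeriv, ← hμ, hw]
    ring
  simp only [Function.comp_apply, e]
  refine (lintegral_exp_centered_le hC hmom hμ0.le hmean (hwC.trans_lt hcC)).trans ?_
  apply ENNReal.ofReal_le_ofReal
  rw [Real.exp_le_exp]
  have h0 : 0 ≤ |w| * C := by positivity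
  exact div_le_div₀ (by positivity) (pow_le_pow_left₀ h0 hwC 2) (by linarith) (by linarith)

end Model

/-! ### Chernoff bounds for the score and the empirical process -/

/-- The tilt `q = w / (D + C w)` gives `1 - q C = D / (D + C w)`; half of `2 D w` pays for the
exponential moment, the remainder `q (D w + C w²)` equals `w²`. -/
lemma chernoff_exponent {C D θ w : ℝ} (hC : 0 < C) (hD : 0 < D) (hw : 0 < w)
    (hDC : C ^ 2 + θ ^ 2 / 2 ≤ D ^ 2) :
    ∃ q, 0 < q ∧ q * C < 1 ∧ (q * C) ^ 2 / (1 - q * C) + (q * θ) ^ 2 / 2 + w ^ 2 ≤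
      q * (2 * D * w + C * w ^ 2) := by
  have hden : 0 < D + C * w := by positivity
  refine ⟨w / (D + C * w), by positivity, ?_, ?_⟩
  · rw [div_mul_eq_mul_div, div_lt_one hden]
    linarith
  · set q := w / (D + C * w) with hq
    have hq0 : 0 < q := by positivity
    have hw' : w = q * (D + C * w) := by rw [hq]; field_simp
    have h1 : 1 - q * C = D / (D + C * w) := by rw [hq]; field_simp; ring
    have h2 : (q * C) ^ 2 / (1 - q * C) + (q * θ) ^ 2 / 2 ≤ q * (D * w) := by
      have h3 : 1 ≤ 1 / (1 - q * C) := by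
        rw [h1, one_div_div, le_div_iff₀ hD]
        nlinarith [mul_pos hC hw]
      calc (q * C) ^ 2 / (1 - q * C) + (q * θ) ^ 2 / 2
          ≤ (q * C) ^ 2 * (1 / (1 - q * C)) + (q * θ) ^ 2 / 2 * (1 / (1 - q * C)) := by
            rw [mul_one_div]
            have := mul_le_mul_of_nonneg_left h3 (by positivity : 0 ≤ (q * θ) ^ 2 / 2)
            linarith
        _ = q ^ 2 * (C ^ 2 + θ ^ 2 / 2) * (1 / (1 - q * C)) := by ring
        _ ≤ q ^ 2 * D ^ 2 * (1 / (1 - q * C)) := by gcongr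
        _ = q * (D * (q * (D + C * w))) := by
            rw [h1]
            field_simp
        _ = q * (D * w) := by rw [← hw']
    have h4 : w ^ 2 = q * (D * w + C * w ^ 2) := by
      calc w ^ 2 = w * w := sq w
        _ = q * (D + C * w) * w := by rw [← hw']
        _ = _ := by ring
    linarith

lemma measure_le_of_exp_le {α : Type*} [MeasurableSpace α] {μ : Measure α} {F : α → ℝ≥0∞}
    (hF : Measurable F) {S : Set α} {r : ℝ} (hS : ∀ z ∈ S, ENNReal.ofReal (Real.exp r) ≤ F z)
    {I : ℝ≥0∞} (hI : ∫⁻ z, F z ∂μ ≤ I) : μ S ≤ ENNReal.ofReal (Real.exp (-r)) * I := by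
  calc μ S = ENNReal.ofReal (Real.exp (-r)) * (ENNReal.ofReal (Real.exp r) * μ S) := by
        rw [← mul_assoc, ← ENNReal.ofReal_mul (Real.exp_nonneg _), ← Real.exp_add]
        simp
    _ ≤ ENNReal.ofReal (Real.exp (-r)) *
        (ENNReal.ofReal (Real.exp r) * μ {z | ENNReal.ofReal (Real.exp r) ≤ F z}) := by
        gcongr
        exact hS
    _ ≤ _ := by
        gcongr
        exact (mul_meas_ge_le_lintegral hF _).trans hI

lemma exp_neg_mul_pow_le {p n : ℕ} {r b w : ℝ} (h : n * b - r ≤ -(n * w ^ 2)) :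
    ENNReal.ofReal (Real.exp (-r)) * (2 * p * ENNReal.ofReal (Real.exp b) ^ n) ≤
      2 * p * ENNReal.ofReal (Real.exp (-(n * w ^ 2))) := by
  rw [mul_left_comm, ← ENNReal.ofReal_pow (Real.exp_nonneg _),
    ← ENNReal.ofReal_mul (Real.exp_nonneg _), ← Real.exp_nat_mul, ← Real.exp_add]
  gcongr
  linarith

section Model

variable {p : ℕ} {ν : Measure (Fin p → ℝ)} [IsProbabilityMeasure ν] {κ : Kernel (Fin p → ℝ) ℕ}
  [IsMarkovKernel κ] {β : Fin p → ℝ} {θ L K C : ℝ}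

/-- Bernstein's inequality for the score. -/
lemma IsCountModel.measure_score_le (h : IsCountModel ν κ β L K C) (hL : 0 < L) (hC : 0 < C)
    (hθ : 0 < θ) {w : ℝ} (hw : 0 < w) (n : ℕ) :
    (Measure.pi fun _ : Fin n => ν ⊗ₘ κ)
      {z | ∃ j, n * (L * (2 * C * w + C * w ^ 2)) < |∑ i, score θ β j (z i)|} ≤
      2 * p * ENNReal.ofReal (Real.exp (-(n * w ^ 2))) := by
  -- The score is centred directly, without the Lipschitz envelope `max y θ`, so the `θ` term drops
  -- out and `D = C`.
  obtain ⟨q, hq, hqC, hexp⟩ := chernoff_exponent (θ := 0) hC hC hw (by simp)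
  set b := (q * C) ^ 2 / (1 - q * C) with hb
  let f : Fin p → Bool → (Fin p → ℝ) × ℕ → ℝ≥0∞ := fun j s z =>
    ENNReal.ofReal (Real.exp (boolSign s * (q / L) * score θ β j z))
  have hfm : ∀ j s, Measurable (f j s) := fun j s =>
    (Real.measurable_exp.comp ((measurable_score θ β j).const_mul _)).ennreal_ofReal
  have hm : ∀ j s, Measurable fun z : Fin n → (Fin p → ℝ) × ℕ => ∏ i, f j s (z i) := fun j s =>
    Finset.measurable_prod _ fun i _ => (hfm j s).comp (measurable_pi_apply i)
  have hfK : ∀ j s, ∫⁻ z, f j s z ∂(ν ⊗ₘ κ) ≤ ENNReal.ofReal (Real.exp b) := by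
    intro j s
    have hc : |boolSign s * (q / L)| * L = q := by
      have : |boolSign s| = 1 := by cases s <;> simp [boolSign]
      rw [abs_mul, this, abs_of_pos (by positivity), one_mul]
      field_simp
    have := h.lintegral_exp_score_le hC.le hθ (c := boolSign s * (q / L)) (by rwa [hc]) j
    rwa [hc] at this
  have hI : ∫⁻ z, ∑ j, ∑ s : Bool, ∏ i, f j s (z i) ∂(Measure.pi fun _ : Fin n => ν ⊗ₘ κ) ≤
      2 * p * ENNReal.ofReal (Real.exp b) ^ n := by
    rw [lintegral_finsetSum _ fun j _ => Finset.measurable_sum _ fun s _ => hm j s]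
    calc _ ≤ ∑ _j : Fin p, ∑ _s : Bool, ENNReal.ofReal (Real.exp b) ^ n := by
          refine Finset.sum_le_sum fun j _ => ?_
          rw [lintegral_finsetSum _ fun s _ => hm j s]
          refine Finset.sum_le_sum fun s _ => ?_
          rw [lintegral_pi_prod (hfm j s) n]
          exact pow_le_pow_left' (hfK j s) n
      _ = _ := by
          simp
          ring
  refine (measure_le_of_exp_le (r := n * (q * (2 * C * w + C * w ^ 2)))
    (Finset.measurable_sum _ fun j _ => Finset.measurable_sum _ fun s _ => hm j s) ?_ hI).trans
    (exp_neg_mul_pow_le ?_)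
  · rintro z ⟨j, hj⟩
    obtain ⟨s, hs⟩ : ∃ s : Bool, |∑ i, score θ β j (z i)| =
        boolSign s * ∑ i, score θ β j (z i) := by
      rcases abs_choice (∑ i, score θ β j (z i)) with h | h
      · exact ⟨true, by simp [boolSign, h]⟩
      · exact ⟨false, by simp [boolSign, h]⟩
    have h1 : ENNReal.ofReal (Real.exp (n * (q * (2 * C * w + C * w ^ 2)))) ≤
        ∏ i, f j s (z i) := by
      rw [← ENNReal.ofReal_prod_of_nonneg fun i _ => Real.exp_nonneg _, ← Real.exp_sum]
      apply ENNReal.ofReal_le_ofReal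
      rw [Real.exp_le_exp, ← Finset.mul_sum]
      rw [hs] at hj
      have := mul_le_mul_of_nonneg_left hj.le (by positivity : 0 ≤ q / L)
      calc _ = q / L * (n * (L * (2 * C * w + C * w ^ 2))) := by field_simp
        _ ≤ _ := this
        _ = _ := by ring
    refine h1.trans ?_
    refine le_trans ?_ (Finset.single_le_sum (f := fun j => ∑ s : Bool, ∏ i, f j s (z i))
      (fun _ _ => zero_le) (Finset.mem_univ j))
    exact Finset.single_le_sum (f := fun s => ∏ i, f j s (z i)) (fun _ _ => zero_le)
      (Finset.mem_univ s)
  · have := mul_le_mul_of_nonneg_left hexp (Nat.cast_nonneg (α := ℝ) n)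
    simp only [mul_zero, ne_eq, OfNat.ofNat_ne_zero, not_false_eq_true, zero_pow, zero_div,
      add_zero] at this
    linarith

lemma continuous_l1Norm : Continuous (l1Norm : (Fin p → ℝ) → ℝ) :=
  continuous_finsetSum _ fun j _ => (continuous_apply j).abs

lemma continuous_dotProduct_left (x : Fin p → ℝ) : Continuous fun u : Fin p → ℝ => x ⬝ᵥ u :=
  continuous_finsetSum _ fun j _ => (continuous_apply j).const_mul _

lemma continuous_lossIncr (hθ : 0 < θ) (β : Fin p → ℝ) (z : (Fin p → ℝ) × ℕ) :
    Continuous fun δ => lossIncr θ β δ z := by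
  have hd : Continuous fun δ : Fin p → ℝ => z.1 ⬝ᵥ (β + δ) :=
    (continuous_dotProduct_left z.1).comp (continuous_const.add continuous_id)
  have hl : Continuous fun δ : Fin p → ℝ => Real.log (θ + Real.exp (z.1 ⬝ᵥ (β + δ))) :=
    (continuous_const.add (Real.continuous_exp.comp hd)).log fun δ => (add_pos hθ (Real.exp_pos _)).ne'
  exact ((hd.const_mul _).neg.add (hl.const_mul _)).sub continuous_const

/-- The risk is Lipschitz in the ℓ₁ norm. This allows the uncountable ball to be replaced by a dense
sequence. -/
lemma IsCountModel.continuous_integral_lossIncr (h : IsCountModel ν κ β L K C) (hθ : 0 < θ) :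
    Continuous fun δ => ∫ z, lossIncr θ β δ z ∂(ν ⊗ₘ κ) := by
  set m := ∫ z, ((z.2 : ℝ) + θ) ∂(ν ⊗ₘ κ) with hm
  have key : ∀ δ δ', |∫ z, lossIncr θ β δ z ∂(ν ⊗ₘ κ) - ∫ z, lossIncr θ β δ' z ∂(ν ⊗ₘ κ)| ≤
      m * (L * l1Norm (δ - δ')) := by
    intro δ δ'
    rw [← integral_sub (h.integrable_lossIncr hθ δ) (h.integrable_lossIncr hθ δ'), hm,
      ← integral_mul_const]
    have hi : Integrable (fun z : (Fin p → ℝ) × ℕ => ((z.2 : ℝ) + θ) * (L * l1Norm (δ - δ')))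
        (ν ⊗ₘ κ) := (h.integrable_snd.add (integrable_const θ)).mul_const _
    exact norm_integral_le_of_norm_le (f := fun z => lossIncr θ β δ z - lossIncr θ β δ' z) hi
      (h.ae_abs_lossIncr_sub_le hθ δ δ')
  refine continuous_iff_continuousAt.2 fun δ₀ => ?_
  refine tendsto_iff_dist_tendsto_zero.2 (squeeze_zero (fun _ => dist_nonneg)
    (fun δ => (Real.dist_eq _ _).trans_le (key δ δ₀)) ?_)
  have : Continuous fun δ => m * (L * l1Norm (δ - δ₀)) :=
    ((continuous_l1Norm.comp (continuous_id.sub continuous_const)).const_mul L).const_mul m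
  have h0 := this.tendsto δ₀
  simpa [l1Norm] using h0

/-- Uniform deviation inequality for the empirical risk increments over an `ℓ₁` ball. -/
lemma IsCountModel.measure_uniform_le (h : IsCountModel ν κ β L K C) (hp : 0 < p) (hL : 0 < L)
    (hC : 0 < C) (hθ : 0 < θ) {D w R : ℝ} (hD : 0 < D) (hDC : C ^ 2 + θ ^ 2 / 2 ≤ D ^ 2)
    (hw : 0 < w) (hR : 0 < R) (n : ℕ) :
    (Measure.pi fun _ : Fin n => ν ⊗ₘ κ)
      {z | ∃ δ, l1Norm δ ≤ R ∧ n * (2 * R * L * (2 * D * w + C * w ^ 2)) <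
        ∑ i, (∫ z', lossIncr θ β δ z' ∂(ν ⊗ₘ κ) - lossIncr θ β δ (z i))} ≤
      2 * p * ENNReal.ofReal (Real.exp (-(n * w ^ 2))) := by
  obtain ⟨q, hq, hqC, hexp⟩ := chernoff_exponent hC hD hw hDC
  set b := (q * C) ^ 2 / (1 - q * C) + (q * θ) ^ 2 / 2 with hb
  -- Scaled so that `2 * R * s * L = q`; the 2 comes from symmetrization and `R` from the ball.
  set s := q / (2 * R * L) with hs
  have hs0 : 0 < s := by positivity
  have : Nonempty {δ : Fin p → ℝ // l1Norm δ ≤ R} := ⟨⟨0, by simpa [l1Norm] using hR.le⟩⟩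
  let u : ℕ → {δ : Fin p → ℝ // l1Norm δ ≤ R} := TopologicalSpace.denseSeq _
  have hI := lintegral_expSup_empirical_le (μ := ν ⊗ₘ κ) (ι := ℕ) hp
    (g := fun z a => -s * lossIncr θ β (u a).1 z)
    (v := fun z j => s * (max (z.2 : ℝ) θ * z.1 j)) (u := fun a => (u a).1) (R := R)
    (K := ENNReal.ofReal (Real.exp b)) (fun a => (u a).2)
    (fun a => (h.integrable_lossIncr hθ _).const_mul _)
    (fun a => (measurable_lossIncr θ β _).const_mul _)
    (measurable_pi_lambda _ fun j => ((measurable_natCast_snd.max measurable_const).mul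
      ((measurable_pi_apply j).comp measurable_fst)).const_mul s) ?_ ?_ ?_ n
  · have hgm : ∀ a, Measurable fun z : Fin n → (Fin p → ℝ) × ℕ =>
        ∑ i, (-s * lossIncr θ β (u a).1 (z i) -
          ∫ z', -s * lossIncr θ β (u a).1 z' ∂(ν ⊗ₘ κ)) := fun a =>
      Finset.measurable_sum _ fun i _ =>
        (((measurable_lossIncr θ β _).comp (measurable_pi_apply i)).const_mul _).sub_const _
    refine (measure_le_of_exp_le (r := n * (q * (2 * D * w + C * w ^ 2)))
      (measurable_expSup hgm) ?_ hI).trans (exp_neg_mul_pow_le ?_)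
    · rintro z ⟨δ, hδ, hlt⟩
      have hcont : Continuous fun δ : {δ : Fin p → ℝ // l1Norm δ ≤ R} =>
          ∑ i, (∫ z', lossIncr θ β δ.1 z' ∂(ν ⊗ₘ κ) - lossIncr θ β δ.1 (z i)) :=
        continuous_finsetSum _ fun i _ =>
          ((h.continuous_integral_lossIncr hθ).sub (continuous_lossIncr hθ β (z i))).comp
            continuous_subtype_val
      -- A strict violation is an open condition on `δ`, so it also occurs at a point of the dense
      -- sequence.
      obtain ⟨_, hmem, ⟨k, rfl⟩⟩ := (TopologicalSpace.denseRange_denseSeq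
        {δ : Fin p → ℝ // l1Norm δ ≤ R}).inter_open_nonempty _
        (isOpen_lt continuous_const hcont) ⟨⟨δ, hδ⟩, hlt⟩
      refine le_trans (ENNReal.ofReal_le_ofReal (Real.exp_le_exp.2 ?_))
        (ofReal_exp_le_expSup _ k)
      have hmem' : n * (2 * R * L * (2 * D * w + C * w ^ 2)) <
        ∑ i, (∫ z', lossIncr θ β (u k).1 z' ∂(ν ⊗ₘ κ) - lossIncr θ β (u k).1 (z i)) := hmem
      have := mul_le_mul_of_nonneg_left hmem'.le hs0.le
      calc _ = s * (n * (2 * R * L * (2 * D * w + C * w ^ 2))) := by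
            rw [hs]; field_simp
        _ ≤ _ := this
        _ = _ := by
            rw [Finset.mul_sum]
            refine Finset.sum_congr rfl fun i _ => ?_
            rw [integral_const_mul]
            ring
    · have := mul_le_mul_of_nonneg_left hexp (Nat.cast_nonneg (α := ℝ) n)
      linarith
  · intro z a
    have h1 := abs_lossIncr_le hθ β (u a).1 z
    have e : (fun j => s * (max (z.2 : ℝ) θ * z.1 j)) ⬝ᵥ (u a).1 =
        s * (max (z.2 : ℝ) θ * (z.1 ⬝ᵥ (u a).1)) := by
      simp only [dotProduct, Finset.mul_sum]
      exact Finset.sum_congr rfl fun j _ => by ring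
    rw [e, abs_mul, abs_mul, abs_mul, abs_neg,
      abs_of_nonneg (hθ.le.trans (le_max_right (z.2 : ℝ) θ))]
    exact mul_le_mul_of_nonneg_left h1 (abs_nonneg _)
  · intro z a a'
    have h1 := abs_lossIncr_sub_le hθ β (u a).1 (u a').1 z
    have e : (fun j => s * (max (z.2 : ℝ) θ * z.1 j)) ⬝ᵥ ((u a).1 - (u a').1) =
        s * (max (z.2 : ℝ) θ * (z.1 ⬝ᵥ ((u a).1 - (u a').1))) := by
      simp only [dotProduct, Finset.mul_sum]
      exact Finset.sum_congr rfl fun j _ => by ring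
    rw [e, ← mul_sub, abs_mul, abs_mul, abs_mul, abs_neg,
      abs_of_nonneg (hθ.le.trans (le_max_right (z.2 : ℝ) θ))]
    exact mul_le_mul_of_nonneg_left h1 (abs_nonneg _)
  · intro j
    have hc : 2 * R * s * L = q := by rw [hs]; field_simp
    have := h.lintegral_cosh_le hL.le hC.le hθ.le (c := 2 * R * s) (by positivity)
      (by rwa [hc]) j
    rw [hc] at this
    simpa only [mul_assoc] using this

end Model

/-! ### Deterministic analysis on the good event -/

section Deterministic

variable {n p : ℕ}

lemma l1Norm_smul {s : ℝ} (hs : 0 ≤ s) (b : Fin p → ℝ) : l1Norm (s • b) = s * l1Norm b := by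
  simp [l1Norm, abs_mul, abs_of_nonneg hs, Finset.mul_sum]

lemma l1Norm_eq_add (H : Finset (Fin p)) (b : Fin p → ℝ) :
    l1Norm b = ∑ j ∈ H, |b j| + ∑ j ∈ Hᶜ, |b j| :=
  (Finset.sum_add_sum_compl H fun j => |b j|).symm

lemma abs_le_l1Norm (b : Fin p → ℝ) (j : Fin p) : |b j| ≤ l1Norm b :=
  Finset.single_le_sum (f := fun j => |b j|) (fun _ _ => abs_nonneg _) (Finset.mem_univ j)

lemma eq_zero_of_not_mem_supp {β : Fin p → ℝ} {j : Fin p} (hj : j ∉ supp β) : β j = 0 := by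
  simpa [supp] using hj

/-- The Elastic-net penalty. -/
def penalty (lam₁ lam₂ : ℝ) (β : Fin p → ℝ) : ℝ := lam₁ * l1Norm β + lam₂ * ∑ j, β j ^ 2

lemma enObjective_eq (θ lam₁ lam₂ : ℝ) (x : Fin n → Fin p → ℝ) (y : Fin n → ℕ) (β : Fin p → ℝ) :
    enObjective θ lam₁ lam₂ x y β =
      1 / n * ∑ i, loss θ (x i ⬝ᵥ β) (y i) + penalty lam₁ lam₂ β := by
  have e : nbLoss θ x y β = 1 / n * ∑ i, loss θ (x i ⬝ᵥ β) (y i) := by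
    unfold nbLoss
    rw [neg_mul, ← mul_neg, ← Finset.sum_neg_distrib]
    congr 1
    exact Finset.sum_congr rfl fun i _ => by unfold loss; ring
  rw [enObjective, e, penalty, add_assoc]

lemma l1Norm_sub_le (β δ : Fin p → ℝ) :
    l1Norm β - l1Norm (β + δ) ≤ ∑ j ∈ supp β, |δ j| - ∑ j ∈ (supp β)ᶜ, |δ j| := by
  rw [l1Norm_eq_add (supp β) β, l1Norm_eq_add (supp β) (β + δ)]
  have h1 : ∑ j ∈ (supp β)ᶜ, |β j| = 0 := Finset.sum_eq_zero fun j hj => by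
    rw [eq_zero_of_not_mem_supp (Finset.mem_compl.1 hj), abs_zero]
  have h2 : ∑ j ∈ (supp β)ᶜ, |(β + δ) j| = ∑ j ∈ (supp β)ᶜ, |δ j| :=
    Finset.sum_congr rfl fun j hj => by
      rw [Pi.add_apply, eq_zero_of_not_mem_supp (Finset.mem_compl.1 hj), zero_add]
  have h3 : ∑ j ∈ supp β, |β j| ≤ ∑ j ∈ supp β, |(β + δ) j| + ∑ j ∈ supp β, |δ j| := by
    rw [← Finset.sum_add_distrib]
    refine Finset.sum_le_sum fun j _ => ?_
    have := abs_sub_abs_le_abs_sub (β j) ((β + δ) j)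
    rw [Pi.add_apply, sub_add_cancel_left, abs_neg] at this
    rw [Pi.add_apply]
    linarith
  linarith

/-- The ridge cross term is at most `2 * lam₂ * B = lam₁ / 4` times the ℓ₁ norm on the support,
which turns 1 into 1.25. -/
lemma penalty_sub_le {β : Fin p → ℝ} {B lam₁ lam₂ : ℝ} (hB : 0 < B) (hβ : l1Norm β ≤ B)
    (h₁ : 0 < lam₁) (h₂ : lam₂ = lam₁ / (8 * B)) (δ : Fin p → ℝ) :
    penalty lam₁ lam₂ β - penalty lam₁ lam₂ (β + δ) ≤
      lam₁ * (1.25 * ∑ j ∈ supp β, |δ j| - ∑ j ∈ (supp β)ᶜ, |δ j|) - lam₂ * ∑ j, δ j ^ 2 := by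
  have h2 : 0 < lam₂ := by rw [h₂]; positivity
  have hquad : ∑ j, β j ^ 2 - ∑ j, (β + δ) j ^ 2 ≤
      2 * B * ∑ j ∈ supp β, |δ j| - ∑ j, δ j ^ 2 := by
    have hcross : -∑ j, β j * δ j ≤ B * ∑ j ∈ supp β, |δ j| := by
      have e : ∑ j, β j * δ j = ∑ j ∈ supp β, β j * δ j :=
        (Finset.sum_subset (Finset.subset_univ _) fun j _ hj => by
          rw [eq_zero_of_not_mem_supp hj, zero_mul]).symm
      rw [e, ← Finset.sum_neg_distrib, Finset.mul_sum]
      refine Finset.sum_le_sum fun j _ => ?_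
      refine (neg_le_abs _).trans ?_
      rw [abs_mul]
      exact mul_le_mul_of_nonneg_right ((abs_le_l1Norm β j).trans hβ) (abs_nonneg _)
    have e : ∑ j, (β + δ) j ^ 2 = ∑ j, β j ^ 2 + 2 * ∑ j, β j * δ j + ∑ j, δ j ^ 2 := by
      rw [Finset.mul_sum, ← Finset.sum_add_distrib, ← Finset.sum_add_distrib]
      exact Finset.sum_congr rfl fun j _ => by rw [Pi.add_apply]; ring
    rw [e]
    linarith
  have e1 := mul_le_mul_of_nonneg_left (l1Norm_sub_le β δ) h₁.le
  have e2 := mul_le_mul_of_nonneg_left hquad h2.le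
  have e3 : lam₂ * (2 * B * ∑ j ∈ supp β, |δ j|) = lam₁ * (0.25 * ∑ j ∈ supp β, |δ j|) := by
    rw [h₂]; field_simp; norm_num; ring
  unfold penalty
  linarith

/-- A crude bound for large `δ`: 2 from the triangle inequality, 0.125 from `lam₂ * B² = lam₁ * B /
8`. -/
lemma penalty_sub_le_of_l1Norm {β : Fin p → ℝ} {B lam₁ lam₂ : ℝ} (hB : 0 < B) (hβ : l1Norm β ≤ B)
    (h₁ : 0 < lam₁) (h₂ : lam₂ = lam₁ / (8 * B)) (δ : Fin p → ℝ) :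
    penalty lam₁ lam₂ β - penalty lam₁ lam₂ (β + δ) ≤ lam₁ * (2.125 * B - l1Norm δ) := by
  have h2 : 0 < lam₂ := by rw [h₂]; positivity
  have hsq : ∑ j, β j ^ 2 ≤ B * B := by
    calc ∑ j, β j ^ 2 ≤ ∑ j, B * |β j| := by
          refine Finset.sum_le_sum fun j _ => ?_
          rw [← sq_abs, sq]
          exact mul_le_mul_of_nonneg_right ((abs_le_l1Norm β j).trans hβ) (abs_nonneg _)
      _ = B * l1Norm β := by rw [← Finset.mul_sum]; rfl
      _ ≤ B * B := mul_le_mul_of_nonneg_left hβ hB.le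
  have hl1 : l1Norm δ ≤ l1Norm β + l1Norm (β + δ) := by
    unfold l1Norm
    rw [← Finset.sum_add_distrib]
    refine Finset.sum_le_sum fun j _ => ?_
    have := abs_sub (β j) (β j + δ j)
    rw [sub_add_cancel_left, abs_neg] at this
    exact this
  have hnn : 0 ≤ lam₂ * ∑ j, (β + δ) j ^ 2 :=
    mul_nonneg h2.le (Finset.sum_nonneg fun _ _ => sq_nonneg _)
  have e1 := mul_le_mul_of_nonneg_left hsq h2.le
  have e2 : lam₂ * (B * B) = lam₁ * (0.125 * B) := by rw [h₂]; field_simp; norm_num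
  have e3 := mul_le_mul_of_nonneg_left (show l1Norm β - l1Norm (β + δ) ≤ 2 * B - l1Norm δ by
    linarith) h₁.le
  unfold penalty
  linarith

lemma penalty_segment_le {lam₁ lam₂ : ℝ} (h₁ : 0 ≤ lam₁) (h₂ : 0 ≤ lam₂) (β δ : Fin p → ℝ) {s : ℝ}
    (hs0 : 0 ≤ s) (hs1 : s ≤ 1) :
    penalty lam₁ lam₂ (β + s • δ) ≤
      (1 - s) * penalty lam₁ lam₂ β + s * penalty lam₁ lam₂ (β + δ) := by
  have e1 : l1Norm (β + s • δ) ≤ (1 - s) * l1Norm β + s * l1Norm (β + δ) := by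
    unfold l1Norm
    rw [Finset.mul_sum, Finset.mul_sum, ← Finset.sum_add_distrib]
    refine Finset.sum_le_sum fun j _ => ?_
    have e : (β + s • δ) j = (1 - s) * β j + s * (β + δ) j := by
      simp only [Pi.add_apply, Pi.smul_apply, smul_eq_mul]; ring
    rw [e]
    refine (abs_add_le _ _).trans (le_of_eq ?_)
    rw [abs_mul, abs_mul, abs_of_nonneg hs0, abs_of_nonneg (sub_nonneg.2 hs1)]
  have e2 : ∑ j, (β + s • δ) j ^ 2 ≤ (1 - s) * ∑ j, β j ^ 2 + s * ∑ j, (β + δ) j ^ 2 := by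
    rw [Finset.mul_sum, Finset.mul_sum, ← Finset.sum_add_distrib]
    refine Finset.sum_le_sum fun j _ => ?_
    simp only [Pi.add_apply, Pi.smul_apply, smul_eq_mul]
    nlinarith [mul_nonneg (mul_nonneg hs0 (sub_nonneg.2 hs1)) (sq_nonneg (δ j))]
  have m1 := mul_le_mul_of_nonneg_left e1 h₁
  have m2 := mul_le_mul_of_nonneg_left e2 h₂
  unfold penalty
  linarith

/-- Convexity of the criterion. The intermediate point need not lie in the parameter domain: only
its criterion value is compared with that at `β`. -/
lemma enObjective_segment_le {θ lam₁ lam₂ : ℝ} (hθ : 0 < θ) (h₁ : 0 ≤ lam₁) (h₂ : 0 ≤ lam₂)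
    (x : Fin n → Fin p → ℝ) (y : Fin n → ℕ) (β δ : Fin p → ℝ)
    (hmin : enObjective θ lam₁ lam₂ x y (β + δ) ≤ enObjective θ lam₁ lam₂ x y β) {s : ℝ}
    (hs0 : 0 ≤ s) (hs1 : s ≤ 1) :
    enObjective θ lam₁ lam₂ x y (β + s • δ) ≤ enObjective θ lam₁ lam₂ x y β := by
  rw [enObjective_eq, enObjective_eq] at *
  have hloss : ∑ i, loss θ (x i ⬝ᵥ (β + s • δ)) (y i) ≤
      (1 - s) * ∑ i, loss θ (x i ⬝ᵥ β) (y i) + s * ∑ i, loss θ (x i ⬝ᵥ (β + δ)) (y i) := by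
    rw [Finset.mul_sum, Finset.mul_sum, ← Finset.sum_add_distrib]
    refine Finset.sum_le_sum fun i _ => ?_
    have := loss_segment_le hθ (x i ⬝ᵥ β) (x i ⬝ᵥ δ) (y i) hs0 hs1
    rwa [dotProduct_add, dotProduct_add, dotProduct_smul, smul_eq_mul]
  have e1 := mul_le_mul_of_nonneg_left hloss (by positivity : (0 : ℝ) ≤ 1 / n)
  have e2 := penalty_segment_le h₁ h₂ β δ hs0 hs1
  have e3 := mul_le_mul_of_nonneg_left hmin hs0
  linarith

lemma penalty_sub_ge {θ lam₁ lam₂ : ℝ} (hn : 0 < n)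
    (x : Fin n → Fin p → ℝ) (y : Fin n → ℕ) (β δ : Fin p → ℝ)
    (hmin : enObjective θ lam₁ lam₂ x y (β + δ) ≤ enObjective θ lam₁ lam₂ x y β) :
    ∑ i, lossIncr θ β δ (x i, y i) ≤
      n * (penalty lam₁ lam₂ β - penalty lam₁ lam₂ (β + δ)) := by
  rw [enObjective_eq, enObjective_eq] at hmin
  have hn' : (0 : ℝ) < n := Nat.cast_pos.2 hn
  have e := mul_le_mul_of_nonneg_left hmin hn'.le
  simp only [mul_add, ← mul_assoc, mul_one_div, div_self hn'.ne', one_mul] at e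
  simp only [lossIncr, Finset.sum_sub_distrib]
  linarith

/-- The loss lies above its tangent, so its increment is at least `-0.12 lam₁ ‖δ‖₁`; against the
penalty this gives `1 - 0.12` off the support and `1.25 + 0.12` on it. -/
lemma cone_of_score_le {θ lam₁ lam₂ B : ℝ} (hn : 0 < n) (hθ : 0 < θ) (hB : 0 < B)
    {x : Fin n → Fin p → ℝ} {y : Fin n → ℕ} {β δ : Fin p → ℝ} (hβ : l1Norm β ≤ B)
    (h₁ : 0 < lam₁) (h₂ : lam₂ = lam₁ / (8 * B))
    (hmin : enObjective θ lam₁ lam₂ x y (β + δ) ≤ enObjective θ lam₁ lam₂ x y β)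
    (hscore : ∀ j, |∑ i, score θ β j (x i, y i)| ≤ n * (0.12 * lam₁)) :
    0.88 * ∑ j ∈ (supp β)ᶜ, |δ j| ≤ 1.37 * ∑ j ∈ supp β, |δ j| := by
  have hn' : (0 : ℝ) < n := Nat.cast_pos.2 hn
  have h2 : 0 < lam₂ := by rw [h₂]; positivity
  have hlow : -(n * (0.12 * lam₁) * l1Norm δ) ≤ ∑ i, lossIncr θ β δ (x i, y i) := by
    have htan : ∑ i, lossDeriv θ (x i ⬝ᵥ β) (y i) * (x i ⬝ᵥ δ) ≤
        ∑ i, lossIncr θ β δ (x i, y i) := by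
      refine Finset.sum_le_sum fun i _ => ?_
      have := loss_tangent hθ (x i ⬝ᵥ β) (x i ⬝ᵥ (β + δ)) (y i)
      rw [dotProduct_add, add_sub_cancel_left] at this
      rwa [lossIncr, dotProduct_add]
    have e : ∑ i, lossDeriv θ (x i ⬝ᵥ β) (y i) * (x i ⬝ᵥ δ) =
        (fun j => ∑ i, score θ β j (x i, y i)) ⬝ᵥ δ := by
      simp only [dotProduct, score, Finset.mul_sum, Finset.sum_mul]
      rw [Finset.sum_comm]
      exact Finset.sum_congr rfl fun j _ => Finset.sum_congr rfl fun i _ => by ring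
    have := (abs_le.1 (abs_dotProduct_le (u := δ) hscore)).1
    linarith
  have hup := penalty_sub_ge hn x y β δ hmin
  have hpen := mul_le_mul_of_nonneg_left (penalty_sub_le hB hβ h₁ h₂ δ) hn'.le
  have hsq : 0 ≤ lam₂ * ∑ j, δ j ^ 2 :=
    mul_nonneg h2.le (Finset.sum_nonneg fun _ _ => sq_nonneg _)
  rw [l1Norm_eq_add (supp β)] at hlow
  set h := ∑ j ∈ supp β, |δ j|
  set g := ∑ j ∈ (supp β)ᶜ, |δ j|
  have hfin : 0 ≤ (n * lam₁) * (1.37 * h - 0.88 * g) := by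
    have := mul_nonneg hn'.le hsq
    linarith
  have := nonneg_of_mul_nonneg_right hfin (by positivity)
  linarith

/-- Here `h`, `g` are the ℓ₁ norms on and off the support, and `v`, `S` the squared ℓ₂ norms on the
support and overall. A vector of norm exactly `T` would make a quadratic in `Q h` and `lam₁ d` with
negative discriminant nonpositive. -/
lemma no_crossing {h g v S q T a k ε lam₁ lam₂ d : ℝ} (hh : 0 ≤ h) (hg : 0.88 * g ≤ 1.37 * h)
    (hd : 0 < d) (hhv : h ^ 2 ≤ d * v) (hv : v ≤ S) (ha : 0 < a) (hk : 0 < k) (hε : 0 ≤ ε)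
    (h₁ : 0 < lam₁) (h₂ : 0 < lam₂) (hq : k * v - ε ≤ q)
    (hT : T = 2.25 ^ 2 * lam₁ * d / (a * k + 2 * lam₂) + (1 + a / lam₁) * ε) (hr : h + g = T)
    (hbasic : a * q ≤ 0.34 * lam₁ * T + 0.1 * lam₁ * ε + (lam₁ * (1.25 * h - g) - lam₂ * S)) :
    False := by
  set Q := a * k + 2 * lam₂ with hQ
  have hQ0 : 0 < Q := by positivity
  set D := 2.25 ^ 2 * lam₁ * d / Q with hD
  have hQD : Q * D = 2.25 ^ 2 * lam₁ * d := by rw [hD]; field_simp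
  have hlT : lam₁ * T = lam₁ * D + lam₁ * ε + a * ε := by rw [hT]; field_simp; ring
  have hv0 : 0 ≤ v := by
    by_contra hneg
    have := mul_neg_of_pos_of_neg hd (not_le.1 hneg)
    nlinarith [sq_nonneg h]
  have e1 := mul_le_mul_of_nonneg_left hq ha.le
  have e2 := mul_le_mul_of_nonneg_left hv h₂.le
  have e3 : 0 ≤ a * k * v := by positivity
  -- The constant rounds up `1 + 1.37 / 0.88`.
  have hTh : lam₁ * T ≤ lam₁ * (2.557 * h) := mul_le_mul_of_nonneg_left (by linarith) h₁.le
  have hlh : 0 ≤ lam₁ * h := by positivity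
  have hlε : 0 ≤ lam₁ * ε := by positivity
  have key : Q / 2 * v ≤ 3.12 * (lam₁ * h) - lam₁ * D := by
    have hg' : lam₁ * g = lam₁ * T - lam₁ * h := by rw [← hr]; ring
    have hQv : Q / 2 * v = a * k * v / 2 + lam₂ * v := by rw [hQ]; ring
    rw [hQv]
    linarith
  -- With `X = Q h` and `Y = lam₁ d` this yields `X² - 6.24 X Y + 10.125 Y² ≤ 0`, impossible because
  -- `3.12² < 10.125`.
  have k1 := mul_le_mul_of_nonneg_left key (by positivity : 0 ≤ 2 * (Q * d))
  have k2 := mul_le_mul_of_nonneg_left hhv (by positivity : 0 ≤ Q ^ 2)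
  have k3 : 2 * (Q * d) * (lam₁ * D) = 2 * 2.25 ^ 2 * (lam₁ * d) ^ 2 := by
    calc _ = 2 * d * lam₁ * (Q * D) := by ring
      _ = _ := by rw [hQD]; ring
  have hY : 0 < (lam₁ * d) ^ 2 := by positivity
  have hsq := sq_nonneg (Q * h - 3.12 * (lam₁ * d))
  ring_nf at k1 k2 k3 hY hsq
  linarith

lemma dotProduct_secondMoment {ν : Measure (Fin p → ℝ)} [IsProbabilityMeasure ν] {L : ℝ}
    (hbdd : ∀ᵐ x ∂ν, ∀ j, |x j| ≤ L) (b : Fin p → ℝ) :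
    b ⬝ᵥ (secondMoment ν *ᵥ b) = ∫ x, (x ⬝ᵥ b) ^ 2 ∂ν := by
  have hint : ∀ j l, Integrable (fun x : Fin p → ℝ => x j * x l) ν := by
    intro j l
    refine Integrable.mono' (integrable_const (L * L))
      ((measurable_pi_apply j).mul (measurable_pi_apply l)).aestronglyMeasurable ?_
    filter_upwards [hbdd] with x hx
    rw [Real.norm_eq_abs, abs_mul]
    exact mul_le_mul (hx j) (hx l) (abs_nonneg _) ((abs_nonneg _).trans (hx j))
  have e : ∀ x : Fin p → ℝ, (x ⬝ᵥ b) ^ 2 = ∑ j, ∑ l, b j * b l * (x j * x l) := by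
    intro x
    rw [sq, dotProduct, Finset.sum_mul_sum]
    exact Finset.sum_congr rfl fun j _ => Finset.sum_congr rfl fun l _ => by ring
  simp only [e]
  rw [integral_finsetSum _ fun j _ => integrable_finsetSum _ fun l _ => (hint j l).const_mul _]
  simp only [dotProduct, Matrix.mulVec, secondMoment, Matrix.of_apply, Finset.mul_sum]
  refine Finset.sum_congr rfl fun j _ => ?_
  rw [integral_finsetSum _ fun l _ => (hint j l).const_mul _]
  refine Finset.sum_congr rfl fun l _ => ?_
  rw [integral_const_mul]
  ring

/-- The oracle inequalities on the event where the score and the empirical process, localized at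
radius `R`, are controlled. -/
theorem oracle_of_deviation {ν : Measure (Fin p → ℝ)} [IsProbabilityMeasure ν]
    {ρ : Measure ((Fin p → ℝ) × ℕ)} {θ L B ε k lam₁ lam₂ M R T a : ℝ} (hn : 0 < n)
    (hθ : 0 < θ) (hB : 0 < B) (hε : 0 ≤ ε) (ha : 0 < a) (h₁ : 0 < lam₁)
    (h₂ : lam₂ = lam₁ / (8 * B)) (hM : M = 16 * B + 2 * ε) {β δ : Fin p → ℝ}
    (hβ : l1Norm β ≤ B) (hbdd : ∀ᵐ x ∂ν, ∀ j, |x j| ≤ L)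
    (hStabil : Stabil (secondMoment ν) (supp β) 3.5 ε k)
    (hT : T = 2.25 ^ 2 * lam₁ * ((supp β).card : ℝ) / (a * k + 2 * lam₂) + (1 + a / lam₁) * ε)
    (hR : R = if (supp β).card = 0 then M else min T M)
    (hcurv : ∀ δ, l1Norm δ ≤ M → a * ∫ x, (x ⬝ᵥ δ) ^ 2 ∂ν ≤ ∫ z, lossIncr θ β δ z ∂ρ)
    {x : Fin n → Fin p → ℝ} {y : Fin n → ℕ}
    (hmin : enObjective θ lam₁ lam₂ x y (β + δ) ≤ enObjective θ lam₁ lam₂ x y β)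
    (hscore : ∀ j, |∑ i, score θ β j (x i, y i)| ≤ n * (0.12 * lam₁))
    (hdev : ∀ δ, l1Norm δ ≤ R → ∑ i, (∫ z, lossIncr θ β δ z ∂ρ - lossIncr θ β δ (x i, y i)) ≤
      n * (0.34 * lam₁ * R + 0.1 * lam₁ * ε)) :
    δ ∈ coneV (supp β) 3.5 (ε / 2) ∧ l1Norm δ ≤ T ∧
      a * ∫ x, (x ⬝ᵥ δ) ^ 2 ∂ν ≤ 3.5 * lam₁ * T + lam₁ * ε := by
  obtain ⟨hk, -, hS⟩ := hStabil
  have hn' : (0 : ℝ) < n := Nat.cast_pos.2 hn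
  have h2 : 0 < lam₂ := by rw [h₂]; positivity
  have hM0 : 0 < M := by rw [hM]; positivity
  have hT0 : 0 ≤ T := by rw [hT]; positivity
  have hcone : ∀ s : ℝ, 0 ≤ s → s ≤ 1 →
      0.88 * ∑ j ∈ (supp β)ᶜ, |(s • δ) j| ≤ 1.37 * ∑ j ∈ supp β, |(s • δ) j| := fun s hs0 hs1 =>
    cone_of_score_le hn hθ hB hβ h₁ h₂
      (enObjective_segment_le hθ h₁.le h2.le x y β δ hmin hs0 hs1) hscore
  have hcone1 := hcone 1 zero_le_one le_rfl
  rw [one_smul] at hcone1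
  have hh0 : 0 ≤ ∑ j ∈ supp β, |δ j| := Finset.sum_nonneg fun _ _ => abs_nonneg _
  refine ⟨?_, ?_⟩
  · show ∑ j ∈ (supp β)ᶜ, |δ j| ≤ 3.5 * ∑ j ∈ supp β, |δ j| + ε / 2
    linarith
  -- With empty support the cone forces `δ = 0`.
  rcases Nat.eq_zero_or_pos (supp β).card with hd | hd
  · have hsupp : supp β = ∅ := Finset.card_eq_zero.1 hd
    have hl : l1Norm δ ≤ 0 := by
      rw [l1Norm_eq_add (supp β)]
      rw [hsupp] at hcone1 ⊢
      simp only [Finset.sum_empty] at hcone1 ⊢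
      linarith
    have hδ : δ = 0 := by
      funext j
      exact abs_nonpos_iff.1 ((abs_le_l1Norm δ j).trans hl)
    refine ⟨hl.trans hT0, ?_⟩
    rw [hδ]
    simp only [dotProduct_zero, ne_eq, OfNat.ofNat_ne_zero, not_false_eq_true, zero_pow,
      integral_zero, mul_zero]
    positivity
  rw [if_neg hd.ne'] at hR
  have hRM : R ≤ M := hR ▸ min_le_right _ _
  have hRT : R ≤ T := hR ▸ min_le_left _ _
  have hd' : (0 : ℝ) < (supp β).card := Nat.cast_pos.2 hd
  have hTpos : 0 < T := by rw [hT]; positivity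
  have hR0 : 0 < R := hR ▸ lt_min hTpos hM0
  have hexc : ∀ s : ℝ, 0 ≤ s → s ≤ 1 → l1Norm (s • δ) ≤ R →
      a * ∫ x, (x ⬝ᵥ (s • δ)) ^ 2 ∂ν ≤ 0.34 * lam₁ * R + 0.1 * lam₁ * ε +
        (penalty lam₁ lam₂ β - penalty lam₁ lam₂ (β + s • δ)) := by
    intro s hs0 hs1 hle
    have e1 := hcurv (s • δ) (hle.trans hRM)
    have e2 := hdev (s • δ) hle
    have e3 := penalty_sub_ge hn x y β (s • δ)
      (enObjective_segment_le hθ h₁.le h2.le x y β δ hmin hs0 hs1)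
    rw [Finset.sum_sub_distrib, Finset.sum_const, Finset.card_univ, Fintype.card_fin,
      nsmul_eq_mul] at e2
    have e4 := mul_le_mul_of_nonneg_left e1 hn'.le
    refine le_of_mul_le_mul_left ?_ hn'
    linarith
  have hloc : l1Norm δ ≤ R := by
    by_contra hlt
    rw [not_le] at hlt
    -- Shrink the error to norm exactly `R`, where curvature and deviation bounds are available.
    set s := R / l1Norm δ with hs
    have hl0 : 0 < l1Norm δ := hR0.trans hlt
    have hs0 : 0 ≤ s := by positivity
    have hs1 : s ≤ 1 := by rw [hs, div_le_one hl0]; exact hlt.le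
    have hsR : l1Norm (s • δ) = R := by rw [l1Norm_smul hs0, hs]; field_simp
    have hex := hexc s hs0 hs1 hsR.le
    rcases le_total M T with hMT | hTM
    · have hRM' : R = M := by rw [hR, min_eq_right hMT]
      have hp := penalty_sub_le_of_l1Norm hB hβ h₁ h₂ (s • δ)
      have hpos : 0 ≤ a * ∫ x, (x ⬝ᵥ (s • δ)) ^ 2 ∂ν :=
        mul_nonneg ha.le (integral_nonneg fun _ => sq_nonneg _)
      rw [hsR, hRM'] at hp
      rw [hRM'] at hex
      -- Impossible for `M = 16 B + 2 ε`, since `0.66 * M` exceeds `2.125 B + 0.1 ε`.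
      have : 0 ≤ lam₁ * (0.34 * M + 0.1 * ε + (2.125 * B - M)) := by linarith
      have := nonneg_of_mul_nonneg_right this h₁
      rw [hM] at this
      linarith
    · have hRT' : R = T := by rw [hR, min_eq_left hTM]
      have hc := hcone s hs0 hs1
      have hp := penalty_sub_le hB hβ h₁ h₂ (s • δ)
      have hh : 0 ≤ ∑ j ∈ supp β, |(s • δ) j| := Finset.sum_nonneg fun _ _ => abs_nonneg _
      -- The cone from the score is homogeneous, so it survives shrinking, and `1.37 / 0.88 < 3.5`.
      have hst := hS (s • δ) (by
        show ∑ j ∈ (supp β)ᶜ, |(s • δ) j| ≤ 3.5 * ∑ j ∈ supp β, |(s • δ) j| + ε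
        linarith)
      rw [dotProduct_secondMoment hbdd] at hst
      have hcs : (∑ j ∈ supp β, |(s • δ) j|) ^ 2 ≤
          (supp β).card * ∑ j ∈ supp β, (s • δ) j ^ 2 := by
        have := sq_sum_le_card_mul_sum_sq (s := supp β) (f := fun j => |(s • δ) j|)
        simpa only [sq_abs] using this
      have hvS : ∑ j ∈ supp β, (s • δ) j ^ 2 ≤ ∑ j, (s • δ) j ^ 2 :=
        Finset.sum_le_sum_of_subset_of_nonneg (Finset.subset_univ _) fun _ _ _ => sq_nonneg _
      rw [hRT'] at hex hsR
      rw [l1Norm_eq_add (supp β)] at hsR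
      exact no_crossing hh hc hd' hcs hvS ha hk hε h₁ h2 hst hT hsR (by linarith)
  refine ⟨hloc.trans hRT, ?_⟩
  have hex := hexc 1 zero_le_one le_rfl (by rwa [one_smul])
  rw [one_smul] at hex
  have hp := penalty_sub_le hB hβ h₁ h₂ δ
  have hsq : 0 ≤ lam₂ * ∑ j, δ j ^ 2 :=
    mul_nonneg h2.le (Finset.sum_nonneg fun _ _ => sq_nonneg _)
  have hg0 : 0 ≤ ∑ j ∈ (supp β)ᶜ, |δ j| := Finset.sum_nonneg fun _ _ => abs_nonneg _
  have hsum := l1Norm_eq_add (supp β) δ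
  have m1 := mul_le_mul_of_nonneg_left hRT h₁.le
  have m2 := mul_le_mul_of_nonneg_left (show ∑ j ∈ supp β, |δ j| ≤ T by linarith) h₁.le
  have m3 := mul_nonneg h₁.le hg0
  have m4 := mul_nonneg h₁.le hε
  have m5 := mul_nonneg h₁.le hT0
  linarith

end Deterministic

/-! ### From the i.i.d. sample to the product model -/

section Sample

variable {Ω : Type*} [MeasurableSpace Ω] {P : Measure Ω} [IsProbabilityMeasure P] {n p : ℕ}
  {θ L B : ℝ} {ν : Measure (Fin p → ℝ)} {β : Fin p → ℝ} {X : Fin n → Ω → Fin p → ℝ}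
  {Y : Fin n → Ω → ℕ}

/-- All conditional laws agree `ν`-almost everywhere, so the kernel of a single index `i₀` describes
every pair. -/
lemma IsNBSample.map_eq_pi (h : IsNBSample P ν θ β X Y) (i₀ : Fin n) :
    P.map (fun ω i => (X i ω, Y i ω)) =
      Measure.pi fun _ => ν ⊗ₘ condDistrib (Y i₀) (X i₀) P := by
  have hν : IsProbabilityMeasure ν := by
    rw [← h.law_X i₀]
    exact Measure.isProbabilityMeasure_map (h.measurable_X i₀).aemeasurable
  rw [(iIndepFun_iff_map_fun_eq_pi_map fun i =>
    ((h.measurable_X i).prodMk (h.measurable_Y i)).aemeasurable).1 h.indep]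
  congr 1
  funext i
  rw [← compProd_map_condDistrib (h.measurable_Y i).aemeasurable, h.law_X i]
  refine Measure.compProd_congr ?_
  filter_upwards [h.cond_law i, h.cond_law i₀] with x h1 h2
  rw [h1, h2]

lemma IsNBSample.isCountModel (h : IsNBSample P ν θ β X Y) (i₀ : Fin n) (hθ : 0 < θ)
    (hL : 0 ≤ L) (hbdd : ∀ᵐ x ∂ν, ∀ j, |x j| ≤ L) (hβ : l1Norm β ≤ B) :
    IsCountModel ν (condDistrib (Y i₀) (X i₀) P) β L (L * B) (momentConst θ (L * B)) := by
  have hpred : ∀ᵐ x ∂ν, |x ⬝ᵥ β| ≤ L * B := by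
    filter_upwards [hbdd] with x hx
    exact (abs_dotProduct_le hx).trans (mul_le_mul_of_nonneg_left hβ hL)
  refine ⟨hbdd, hpred, ?_, ?_⟩
  · filter_upwards [hpred, h.cond_law i₀] with x hx hlaw k hk
    rw [hlaw]
    exact lintegral_pow_nbMeasure_le hθ hx hk
  · filter_upwards [h.cond_law i₀] with x hlaw
    rw [hlaw]
    exact lintegral_id_nbMeasure hθ (Real.exp_pos _)

end Sample

/-! ### Numerical thresholds and conclusion -/

lemma two_mul_exp_neg_eq {p : ℕ} (hp : 0 < p) {A s : ℝ} (hs : s = A ^ 2 * Real.log (2 * p)) :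
    2 * (p : ℝ≥0∞) * ENNReal.ofReal (Real.exp (-s)) =
      ENNReal.ofReal ((2 * (p : ℝ)) ^ (1 - A ^ 2)) := by
  have hp' : (0 : ℝ) < 2 * p := by positivity
  have e : (2 * (p : ℝ≥0∞)) = ENNReal.ofReal (2 * p) := by
    rw [ENNReal.ofReal_mul two_pos.le]; simp
  rw [e, ← ENNReal.ofReal_mul hp'.le, hs, sub_eq_add_neg, Real.rpow_add hp', Real.rpow_one,
    Real.rpow_def_of_pos hp' (-A ^ 2)]
  congr 3
  ring

/-- Numerically, `2 / (16 * 1.41) + 1 / 32 < 0.12`. -/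
lemma score_threshold_le {L C w lam₁ : ℝ}
    (hG₁ : 32 * (L * C * w ^ 2) ≤ lam₁) (hG₂ : 16 * √2 * (L * C * w) ≤ lam₁)
    (h0 : 0 ≤ L * C * w) : L * (2 * C * w + C * w ^ 2) ≤ 0.12 * lam₁ := by
  have h2 : (1.41 : ℝ) ≤ √2 := Real.le_sqrt_of_sq_le (by norm_num)
  have := mul_le_mul_of_nonneg_right h2 h0
  linarith

/-- The `C` terms cost twice the score threshold, `0.24 lam₁ R`. The `θ` term costs `0.1 lam₁ R (M +
ε) / M`, and `R ≤ M` bounds its `ε` part by `0.1 lam₁ ε`. -/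
lemma uniform_threshold_le {L C w lam₁ θ M R ε : ℝ}
    (hG₁ : 32 * (L * C * w ^ 2) ≤ lam₁) (hG₂ : 16 * √2 * (L * C * w) ≤ lam₁)
    (hG₃ : 20 * √2 * (θ * L * w) * M ≤ lam₁ * (M + ε)) (h0 : 0 ≤ L * C * w) (h₁ : 0 ≤ lam₁)
    (hR : 0 ≤ R) (hRM : R ≤ M) (hM : 0 < M) (hε : 0 ≤ ε) :
    2 * R * L * (2 * (C + θ / √2) * w + C * w ^ 2) ≤ 0.34 * lam₁ * R + 0.1 * lam₁ * ε := by
  have h2 : (1.41 : ℝ) ≤ √2 := Real.le_sqrt_of_sq_le (by norm_num)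
  have h3 := mul_le_mul_of_nonneg_right h2 h0
  have hdiv : θ / √2 = θ * √2 / 2 := by
    rw [div_eq_div_iff (by positivity) two_ne_zero, mul_assoc, Real.mul_self_sqrt two_pos.le]
  have a1 := mul_le_mul_of_nonneg_left (show 4 * (L * C * w) + 2 * (L * C * w ^ 2) ≤ 0.24 * lam₁ by
    linarith) hR
  have a2 : R * (2 * √2 * (θ * L * w)) ≤ 0.1 * lam₁ * R + 0.1 * lam₁ * ε := by
    refine le_of_mul_le_mul_right ?_ hM
    have b1 := mul_le_mul_of_nonneg_left hG₃ (by positivity : 0 ≤ 0.1 * R)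
    have b2 := mul_le_mul_of_nonneg_left hRM (by positivity : 0 ≤ 0.1 * lam₁ * ε)
    linarith
  rw [hdiv]
  linarith

/-- The bad sets need not be measurable (suprema over a continuum, an arbitrary choice of
minimiser), so the complement of a measurable hull is taken. -/
lemma exists_measurable_good_event {Ω : Type*} [MeasurableSpace Ω] {P : Measure Ω}
    [IsProbabilityMeasure P] {S₁ S₂ S₃ : Set Ω} {c : ℝ} (hc : 0 ≤ c)
    (h₁ : P S₁ ≤ ENNReal.ofReal c) (h₂ : P S₂ ≤ ENNReal.ofReal c) (h₃ : P S₃ = 0) :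
    ∃ E, MeasurableSet E ∧ 1 - 2 * c ≤ P.real E ∧ ∀ ω ∈ E, ω ∉ S₁ ∧ ω ∉ S₂ ∧ ω ∉ S₃ := by
  refine ⟨(toMeasurable P (S₁ ∪ S₂ ∪ S₃))ᶜ, (measurableSet_toMeasurable _ _).compl, ?_, ?_⟩
  · rw [probReal_compl_eq_one_sub (measurableSet_toMeasurable _ _)]
    have hle : P (S₁ ∪ S₂ ∪ S₃) ≤ ENNReal.ofReal (2 * c) := by
      refine (measure_union_le _ _).trans ?_
      rw [h₃, add_zero]
      refine (measure_union_le _ _).trans ((add_le_add h₁ h₂).trans (le_of_eq ?_))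
      rw [← ENNReal.ofReal_add hc hc, two_mul]
    have : P.real (toMeasurable P (S₁ ∪ S₂ ∪ S₃)) ≤ 2 * c := by
      rw [measureReal_def, measure_toMeasurable]
      exact ENNReal.toReal_le_of_le_ofReal (by positivity) hle
    linarith
  · intro ω hω
    have := fun h => hω (subset_toMeasurable P _ h)
    simp only [Set.mem_union] at this
    tauto

end NBReg

end

theorem mainTheorem3 {Ω : Type*} [MeasurableSpace Ω] (P : Measure Ω) [IsProbabilityMeasure P]
    (n p : ℕ) (hn : 0 < n) (hp : 0 < p)
    (θ L B ε k A lam₁ lam₂ M a C : ℝ)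
    (hθ : 0 < θ) (hL : 0 < L) (hB : 0 < B) (hε : 0 ≤ ε) (hA : 1 < A)
    (ν : Measure (Fin p → ℝ)) (βstar : Fin p → ℝ)
    (X : Fin n → Ω → Fin p → ℝ) (Y : Fin n → Ω → ℕ)
    (hsample : NBReg.IsNBSample P ν θ βstar X Y)
    (hbdd : ∀ᵐ x ∂ν, ∀ j, |x j| ≤ L)
    (hβ : NBReg.l1Norm βstar ≤ B)
    (hM : M = 16 * B + 2 * ε)
    (ha : a = NBReg.curvConst θ L B M)
    (hC : C = NBReg.momentConst θ (L * B))
    (hStabil : NBReg.Stabil (NBReg.secondMoment ν) (NBReg.supp βstar) 3.5 ε k)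
    (hG₁ : 32 * A ^ 2 * L * C * (Real.log (2 * p) / n) ≤ lam₁)
    (hG₂ : 16 * √2 * A * L * C * √(Real.log (2 * p) / n) ≤ lam₁)
    (hG₃ : 20 * θ * A * M * L / (M + ε) * √(2 * Real.log (2 * p) / n) ≤ lam₁)
    (hlam₂ : lam₂ = lam₁ / (8 * B))
    (D : Set (Fin p → ℝ)) (hD : βstar ∈ D)
    (βhat : Ω → Fin p → ℝ)
    (hβhat : ∀ᵐ ω ∂P, NBReg.IsElasticNet D θ lam₁ lam₂ (fun i => X i ω) (fun i => Y i ω)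
      (βhat ω)) :
    0 < a ∧
    ∃ E : Set Ω, MeasurableSet E ∧
      1 - 2 * (2 * (p : ℝ)) ^ (1 - A ^ 2) - (2 * (p : ℝ)) ^ (-A ^ 2) ≤ P.real E ∧
      ∀ ω ∈ E,
        βhat ω - βstar ∈ NBReg.coneV (NBReg.supp βstar) 3.5 (ε / 2) ∧
        NBReg.l1Norm (βhat ω - βstar) ≤
          2.25 ^ 2 * lam₁ * ((NBReg.supp βstar).card : ℝ) / (a * k + 2 * lam₂) +
            (1 + a / lam₁) * ε ∧
        ∫ x, (x ⬝ᵥ (βstar - βhat ω)) ^ 2 ∂ν ≤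
          17.71875 * ((NBReg.supp βstar).card : ℝ) * lam₁ ^ 2 / (a * (a * k + 2 * lam₂)) +
            (4.5 * lam₁ / a + 3.5) * ε := by
  
  have hM0 : 0 < M := by rw [hM]; positivity
  have ha0 : 0 < a := ha ▸ NBReg.curvConst_pos hθ hL.le hB.le hM0.le
  refine ⟨ha0, ?_⟩
  have hC1 : 1 ≤ C := hC ▸ NBReg.one_le_momentConst hθ (by positivity)
  have hC0 : 0 < C := by linarith
  have hn' : (0 : ℝ) < n := Nat.cast_pos.2 hn
  have hp1 : (1 : ℝ) ≤ p := Nat.one_le_cast.2 hp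
  have hp2 : (0 : ℝ) < 2 * p := by positivity
  have hlog : 0 < Real.log (2 * p) := Real.log_pos (by linarith)
  -- Normalised so that `2p * exp (-n w²) = (2p) ^ (1 - A²)`.
  set w := A * √(Real.log (2 * p) / n) with hw
  have hw0 : 0 < w := by positivity
  have hw2 : w ^ 2 = A ^ 2 * (Real.log (2 * p) / n) := by
    rw [hw, mul_pow, Real.sq_sqrt (by positivity)]
  have hnw : n * w ^ 2 = A ^ 2 * Real.log (2 * p) := by rw [hw2]; field_simp
  have g₁ : 32 * (L * C * w ^ 2) ≤ lam₁ := by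
    rw [hw2]
    linarith
  have g₂ : 16 * √2 * (L * C * w) ≤ lam₁ := by
    rw [hw]
    linarith
  have g₃ : 20 * √2 * (θ * L * w) * M ≤ lam₁ * (M + ε) := by
    rw [mul_div_assoc 2, Real.sqrt_mul two_pos.le, div_mul_eq_mul_div,
      div_le_iff₀ (by positivity)] at hG₃
    rw [hw]
    linarith
  have h₁ : 0 < lam₁ := lt_of_lt_of_le (by positivity) g₁
  have hlcw : 0 ≤ L * C * w := by positivity
  let i₀ : Fin n := ⟨0, hn⟩
  have hν : IsProbabilityMeasure ν := by
    rw [← hsample.law_X i₀]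
    exact Measure.isProbabilityMeasure_map (hsample.measurable_X i₀).aemeasurable
  have hmodel := hsample.isCountModel i₀ hθ hL.le hbdd hβ
  rw [← hC] at hmodel
  have hpi := hsample.map_eq_pi i₀
  set κ := condDistrib (Y i₀) (X i₀) P with hκ
  have hmeas : Measurable fun ω i => (X i ω, Y i ω) :=
    measurable_pi_lambda _ fun i => (hsample.measurable_X i).prodMk (hsample.measurable_Y i)
  set T := 2.25 ^ 2 * lam₁ * ((NBReg.supp βstar).card : ℝ) / (a * k + 2 * lam₂) +
    (1 + a / lam₁) * ε with hT
  -- With empty support `T` vanishes when `ε = 0`; taking `M` there keeps the radius positive.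
  set R := if (NBReg.supp βstar).card = 0 then M else min T M with hR
  have hlam₂pos : 0 < lam₂ := by rw [hlam₂]; positivity
  have hkpos : 0 < k := hStabil.1
  have hRM : R ≤ M := by
    rw [hR]; split_ifs
    exacts [le_rfl, min_le_right _ _]
  have hR0 : 0 < R := by
    rw [hR]
    split_ifs with hd
    · exact hM0
    · have hd' : (0 : ℝ) < (NBReg.supp βstar).card := Nat.cast_pos.2 (Nat.pos_of_ne_zero hd)
      exact lt_min (by rw [hT]; positivity) hM0
  have hDC : C ^ 2 + θ ^ 2 / 2 ≤ (C + θ / √2) ^ 2 := by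
    have e : (θ / √2) ^ 2 = θ ^ 2 / 2 := by rw [div_pow, Real.sq_sqrt two_pos.le]
    have : 0 ≤ C * (θ / √2) := by positivity
    linarith [add_sq C (θ / √2)]
  have hbad₁ := hmodel.measure_score_le hL hC0 hθ hw0 n
  have hbad₂ := hmodel.measure_uniform_le hp hL hC0 hθ (by positivity : 0 < C + θ / √2) hDC hw0
    hR0 n
  rw [NBReg.two_mul_exp_neg_eq hp hnw, ← hpi] at hbad₁ hbad₂
  obtain ⟨E, hEm, hE, hgood⟩ := NBReg.exists_measurable_good_event (P := P)
    (Real.rpow_nonneg hp2.le _)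
    ((Measure.le_map_apply hmeas.aemeasurable _).trans hbad₁)
    ((Measure.le_map_apply hmeas.aemeasurable _).trans hbad₂) (ae_iff.1 hβhat)
  -- Only two bad events have positive cost; the term `(2p) ^ (-A²)` is slack.
  refine ⟨E, hEm, by linarith [Real.rpow_nonneg hp2.le (-A ^ 2)], fun ω hω => ?_⟩
  obtain ⟨hω₁, hω₂, hω₃⟩ := hgood ω hω
  simp only [Set.mem_preimage, Set.mem_ofPred_eq, not_exists, not_lt, not_and, not_not]
    at hω₁ hω₂ hω₃
  have hmin := hω₃.2 βstar hD
  set δ := βhat ω - βstar with hδ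
  rw [show βhat ω = βstar + δ by rw [hδ]; abel] at hmin
  obtain ⟨c₁, c₂, c₃⟩ := NBReg.oracle_of_deviation hn hθ hB hε ha0 h₁ hlam₂ hM hβ hbdd hStabil hT hR
    (fun δ hδ => ha ▸ hmodel.curvature hθ hL.le hM0.le hδ) hmin
    (fun j => (hω₁ j).trans (mul_le_mul_of_nonneg_left
      (NBReg.score_threshold_le g₁ g₂ hlcw) hn'.le))
    (fun δ hδ => (hω₂ δ hδ).trans (mul_le_mul_of_nonneg_left
      (NBReg.uniform_threshold_le g₁ g₂ g₃ hlcw h₁.le hR0.le hRM hM0 hε) hn'.le))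
  refine ⟨c₁, c₂, ?_⟩
  have e : ∀ x : Fin p → ℝ, (x ⬝ᵥ (βstar - βhat ω)) ^ 2 = (x ⬝ᵥ δ) ^ 2 := fun x => by
    rw [hδ, ← neg_sub (βhat ω), dotProduct_neg, neg_sq]
  simp only [e]
  -- Expanding `T`: `3.5 * 2.25² = 17.71875`, and the extra `lam₁ ε` raises 3.5 to 4.5 in the `lam₁
  -- / a` term.
  refine (le_div_iff₀' ha0).2 c₃ |>.trans (le_of_eq ?_)
  rw [hT]
  field_simp
  ring
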